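/- Let $S$ be a left cancellative monoid with identity $e$, and let $C^*_r(S)\subset B(\ell^2(S))$ be the C*-algebra generated by the isometries $\lambda_s\delta_t=\delta_{st}$, $s\in S$. **Left inverse hull.** Let $I_\ell(S)$ be the inverse semigroup of partial bijections of $S$ generated by the left translations $S\to sS$, $t\mapsto st$ ($s\in S$); an element $s\in S$ is identified with the corresponding left translation. Let $E(S)$ be the semigroup of idempotents of $I_\ell(S)$, let $\mathcal J(S)$ be the collection of domains of elements of $E(S)$ (the constructible right ideals of $S$), and for $X\in\mathcal J(S)$ let $p_X\in E(S)$ be the identity map of $X$. **Strong C*-regularity.** $S$ is called strongly C*-regular if, whenever $h_1,\dots,h_n\in I_\ell(S)$ and $X,X_1,\dots,X_m\in\mathcal J(S)$ (with $m\ge 0$) satisfy $$\emptyset\neq X\setminus\bigcup_{i=1}^m X_i\subset\bigcup_{k=1}^n\{s\in S: h_k s=s\},$$ there are $Y_1,\dots,Y_l\in\mathcal J(S)$ and indices $1\le k_j\le n$ ($1\le j\le l$) such that $$X\setminus\bigcup_{i=1}^m X_i\subset\bigcup_{j=1}^l Y_j\quad\text{and}\quad h_{k_j}p_{Y_j}=p_{Y_j}\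 \text{ for all } 1\le j\le l .$$ **The groupoid.** Let $\widehat{E(S)}$ be the space of nonzero semigroup homomorphisms $\chi\colon E(S)\to\{0,1\}$ with the topology of pointwise convergence. The Paterson groupoid $\mathcal G(I_\ell(S))$ has unit space $\widehat{E(S)}$; its arrows are the classes $[g,\chi]$ of pairs $(g,\chi)\in I_\ell(S)\times\widehat{E(S)}$ with $\chi(g^{-1}g)=1$, where $[g_1,\chi_1]=[g_2,\chi_2]$ iff $\chi_1=\chi_2$ and $g_1p=g_2p$ for some $p\in E(S)$ with $\chi_1(p)=1$. The source of $[g,\chi]$ is $\chi$, its range is $\chi(g^{-1}\cdot g)$, the product is $[g,\chi][h,\psi]=[gh,\psi]$ for $\chi=\psi(h^{-1}\cdot h)$, and a basis of the topology is given by the sets $\{[g,\chi]:\chi\in U\}$ with $g\in I_\ell(S)$ and $U$ an open subset of $\{\chi:\chi(g^{-1}g)=1\}$. Let $\chi_e\in\widehat{E(S)}$ be defined by $\chi_e(p_X)=1$ iff $e\in X$, let $\Omega(S)$ be the closure of the orbit of $\chi_e$ in $\widehat{E(S)}$, and let $\mathcal G_P(S)$ be the reduction of $\mathcal G(I_\ell(S))$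 to $\Omega(S)$, with the subspace topology. **Reduced groupoid C*-algebra.** For an étale, not necessarily Hausdorff, groupoid $\mathcal G$ with source map $s$ and range map $r$, put $\mathcal G_x=s^{-1}(x)$ and $\mathcal G^x=r^{-1}(x)$, and let $C_c(\mathcal G)$ be the linear span of the functions on $\mathcal G$ that are continuous with compact support on some open Hausdorff subset and are extended by zero. For every unit $x$ and $f\in C_c(\mathcal G)$ define $\rho_x(f)\in B(\ell^2(\mathcal G_x))$ by $(\rho_x(f)\xi)(g)=\sum_{h\in\mathcal G^{r(g)}}f(h)\xi(h^{-1}g)$. Let $C^*_r(\mathcal G)$ be the completion of $C_c(\mathcal G)$, with the convolution product and the involution $f^*(g)=\overline{f(g^{-1})}$, in the norm $\|f\|_r=\sup_x\|\rho_x(f)\|$; each $\rho_x$ extends to $C^*_r(\mathcal G)$. **Proposition.** Assume that $S$ is strongly C*-regular. Identify $S$ with $\mathcal G_P(S)_{\chi_e}$ by the bijection $s\mapsto[s,\chi_e]$, and hence $\ell^2(\mathcal G_P(S)_{\chi_e})$ with $\ell^2(S)$. Then the representation $\rho_{\chi_e}$ of $C^*_r(\mathcal G_P(S))$ is a $*$-isomorphism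 of $C^*_r(\mathcal G_P(S))$ onto $C^*_r(S)$; that is, there is a $*$-isomorphism $\Phi\colon C^*_r(\mathcal G_P(S))\to C^*_r(S)$ with $\Phi(a)=\rho_{\chi_e}(a)$ for all $a\in C^*_r(\mathcal G_P(S))$. -/

import Mathlib

open CategoryTheory Topology
open scoped ENNReal

noncomputable section

/-! ## Hilbert spaces `ℓ²(α)` -/

/-- The Hilbert space `ℓ²(α)`. -/
abbrev EllTwo (α : Type*) : Type _ := lp (fun _ : α => ℂ) 2

namespace EllTwo

/-- Weighted partial permutations are bounded operators. -/
theorem exists_weighted {α β : Type*} (φ : β → α) (w : β → ℂ) (C : ℝ) (hC : 0 ≤ C)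
    (hφ : Set.InjOn φ {b | w b ≠ 0}) (hw : ∀ b, ‖w b‖ ≤ C) :
    ∃ T : EllTwo α →L[ℂ] EllTwo β, ‖T‖ ≤ C ∧ ∀ ξ b, T ξ b = w b * ξ (φ b) := by
  classical
  have h2 : (0 : ℝ) < (2 : ℝ≥0∞).toReal := by norm_num
  have key : ∀ (ξ : EllTwo α) (s : Finset β),
      ∑ b ∈ s, ‖w b * ξ (φ b)‖ ^ (2 : ℝ≥0∞).toReal ≤ (C * ‖ξ‖) ^ (2 : ℝ≥0∞).toReal := by
    intro ξ s
    have hsub : (↑(s.filter fun b => w b ≠ 0) : Set β) ⊆ {b | w b ≠ 0} := by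
      intro b hb
      simpa using (Finset.mem_filter.1 hb).2
    calc ∑ b ∈ s, ‖w b * ξ (φ b)‖ ^ (2 : ℝ≥0∞).toReal
        = ∑ b ∈ s.filter (fun b => w b ≠ 0), ‖w b * ξ (φ b)‖ ^ (2 : ℝ≥0∞).toReal := by
          rw [Finset.sum_filter]
          refine Finset.sum_congr rfl fun b _ => ?_
          by_cases hb : w b = 0
          · simp [hb]
          · simp [hb]
      _ ≤ ∑ b ∈ s.filter (fun b => w b ≠ 0),
            C ^ (2 : ℝ≥0∞).toReal * ‖ξ (φ b)‖ ^ (2 : ℝ≥0∞).toReal := by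
          refine Finset.sum_le_sum fun b _ => ?_
          rw [norm_mul, Real.mul_rpow (norm_nonneg _) (norm_nonneg _)]
          gcongr
          exact hw b
      _ = C ^ (2 : ℝ≥0∞).toReal *
            ∑ a ∈ (s.filter (fun b => w b ≠ 0)).image φ, ‖ξ a‖ ^ (2 : ℝ≥0∞).toReal := by
          rw [Finset.sum_image (hφ.mono hsub), Finset.mul_sum]
      _ ≤ C ^ (2 : ℝ≥0∞).toReal * ‖ξ‖ ^ (2 : ℝ≥0∞).toReal := by
          gcongr
          exact lp.sum_rpow_le_norm_rpow h2 ξ _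
      _ = (C * ‖ξ‖) ^ (2 : ℝ≥0∞).toReal := by
          rw [Real.mul_rpow hC (norm_nonneg _)]
  let T₀ : EllTwo α →ₗ[ℂ] EllTwo β :=
    { toFun := fun ξ => ⟨fun b => w b * ξ (φ b), memℓp_gen' (key ξ)⟩
      map_add' := fun ξ η => lp.ext (funext fun b => mul_add _ _ _)
      map_smul' := fun c ξ => lp.ext (funext fun b => mul_left_comm _ _ _) }
  refine ⟨T₀.mkContinuous C fun ξ => ?_, LinearMap.mkContinuous_norm_le _ hC _, fun ξ b => rfl⟩
  exact lp.norm_le_of_forall_sum_le h2 (by positivity) (key ξ)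

/-- The unitary `ℓ²(α) ≅ ℓ²(β)` induced by a bijection `α ≃ β`. -/
def reindex {α β : Type*} (e : α ≃ β) : EllTwo α ≃ₗᵢ[ℂ] EllTwo β where
  toFun ξ := ⟨fun b => ξ (e.symm b), memℓp_gen (by
    have h := (lp.memℓp ξ).summable (by norm_num)
    exact (e.symm.summable_iff (f := fun i => ‖ξ i‖ ^ (2 : ℝ≥0∞).toReal)).2 h)⟩
  invFun ξ := ⟨fun a => ξ (e a), memℓp_gen (by
    have h := (lp.memℓp ξ).summable (by norm_num)
    exact (e.summable_iff (f := fun i => ‖ξ i‖ ^ (2 : ℝ≥0∞).toReal)).2 h)⟩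
  map_add' _ _ := rfl
  map_smul' _ _ := rfl
  left_inv ξ := lp.ext (funext fun a => congrArg ξ (e.symm_apply_apply a))
  right_inv ξ := lp.ext (funext fun a => congrArg ξ (e.apply_symm_apply a))
  norm_map' ξ := by
    rw [lp.norm_eq_tsum_rpow (by norm_num), lp.norm_eq_tsum_rpow (by norm_num)]
    congr 1
    exact e.symm.tsum_eq (fun i => ‖ξ i‖ ^ (2 : ℝ≥0∞).toReal)

end EllTwo

/-- The C*-algebra `∏_x B(H_x)` of bounded families of operators on Hilbert spaces, with the
supremum norm. -/
def BoundedFamilies {X : Type*} (H : X → Type*) [∀ x, NormedAddCommGroup (H x)]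
    [∀ x, InnerProductSpace ℂ (H x)] : Type _ :=
  lp (fun x => H x →L[ℂ] H x) ∞

namespace BoundedFamilies

variable {X : Type*} (H : X → Type*) [∀ x, NormedAddCommGroup (H x)]
  [∀ x, InnerProductSpace ℂ (H x)] [∀ x, CompleteSpace (H x)]

instance : NonUnitalCStarAlgebra (BoundedFamilies H) :=
  inferInstanceAs (NonUnitalCStarAlgebra (lp (fun x => H x →L[ℂ] H x) ∞))

variable {H}

/-- The bounded family with the given members. -/
def mk (T : ∀ x, H x →L[ℂ] H x) (hT : BddAbove (Set.range fun x => ‖T x‖)) : BoundedFamilies H :=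
  (⟨T, memℓp_infty hT⟩ : lp (fun x => H x →L[ℂ] H x) ∞)

/-- The evaluation at `x`. -/
def eval (x : X) : BoundedFamilies H →⋆ₙₐ[ℂ] (H x →L[ℂ] H x) where
  toFun a := (show lp (fun x => H x →L[ℂ] H x) ∞ from a) x
  map_smul' _ _ := rfl
  map_zero' := rfl
  map_add' _ _ := rfl
  map_mul' _ _ := rfl
  map_star' _ := rfl

theorem eval_mk (T : ∀ x, H x →L[ℂ] H x) (hT : BddAbove (Set.range fun x => ‖T x‖)) (x : X) :
    eval x (mk T hT) = T x := rfl

theorem norm_eq_iSup (a : BoundedFamilies H) : ‖a‖ = ⨆ x, ‖eval x a‖ := rfl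

end BoundedFamilies

/-! ## Reduced C*-algebras of étale groupoids

A groupoid is a category all of whose arrows are invertible; its unit space is the type `X` of
objects.  The composition `g ≫ h` is the product `hg` of the groupoid. -/

/-- The set of all arrows of a groupoid with unit space `X`. -/
@[ext] structure Arr (X : Type*) [Groupoid X] where
  /-- the source of the arrow -/
  src : X
  /-- the range of the arrow -/
  tgt : X
  /-- the arrow itself -/
  hom : src ⟶ tgt

/-- The fiber `𝒢_x = s⁻¹(x)`. -/
abbrev SourceFiber {X : Type*} [Groupoid X] (x : X) : Type _ := Σ y : X, (x ⟶ y)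

/-- The fiber `𝒢^y = r⁻¹(y)`. -/
abbrev RangeFiber {X : Type*} [Groupoid X] (y : X) : Type _ := Σ z : X, (z ⟶ y)

/-- An element of `𝒢^y` as an arrow. -/
def RangeFiber.toArr {X : Type*} [Groupoid X] {y : X} (h : RangeFiber y) : Arr X := ⟨h.1, y, h.2⟩

/-- The open bisections (open sets on which source and range are injective) cover the groupoid.
This holds in every étale groupoid, and makes the operators `ρ_x(f)` below bounded. -/
class HasOpenBisections (X : Type*) [Groupoid X] [TopologicalSpace (Arr X)] : Prop where
  exists_bisection : ∀ γ : Arr X, ∃ U : Set (Arr X), IsOpen U ∧ γ ∈ U ∧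
    Set.InjOn Arr.src U ∧ Set.InjOn Arr.tgt U

/-- The space `C_c(𝒢)` of a not necessarily Hausdorff groupoid: the span in the space of all
functions of the functions that are continuous and compactly supported on an open Hausdorff subset
`V`, extended by zero. -/
def Cc (X : Type*) [Groupoid X] [TopologicalSpace (Arr X)] : Submodule ℂ (Arr X → ℂ) :=
  Submodule.span ℂ {f | ∃ V : Set (Arr X), IsOpen V ∧ T2Space V ∧ ContinuousOn f V ∧
    ∃ K : Set (Arr X), K ⊆ V ∧ IsCompact K ∧ ∀ γ, γ ∉ K → f γ = 0}

section RegularRepresentations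

variable {X : Type*} [Groupoid X]

/-- The formula `(ρ_x(f)ξ)(g) = ∑_{h ∈ 𝒢^{r(g)}} f(h) ξ(h⁻¹g)` for `g ∈ 𝒢_x`. -/
def convApply (f : Arr X → ℂ) {x : X} (ξ : EllTwo (SourceFiber x)) (g : SourceFiber x) : ℂ :=
  ∑' h : RangeFiber g.1, f h.toArr * ξ ⟨h.1, g.2 ≫ Groupoid.inv h.2⟩

/-- Functions with finite supports on the fibers `𝒢^y` that act by bounded operators, with a bound
that is uniform in `x`. -/
def boundedConv (X : Type*) [Groupoid X] : Submodule ℂ (Arr X → ℂ) where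
  carrier := {f | (∀ y : X, {h : RangeFiber y | f h.toArr ≠ 0}.Finite) ∧
    ∃ C : ℝ, 0 ≤ C ∧ ∀ x : X, ∃ T : EllTwo (SourceFiber x) →L[ℂ] EllTwo (SourceFiber x),
      ‖T‖ ≤ C ∧ ∀ ξ g, T ξ g = convApply f ξ g}
  zero_mem' := by
    refine ⟨fun y => by simp, 0, le_rfl, fun x => ⟨0, by simp, fun ξ g => ?_⟩⟩
    simp [convApply]
  add_mem' := by
    rintro f₁ f₂ ⟨hf₁, C₁, hC₁, h₁⟩ ⟨hf₂, C₂, hC₂, h₂⟩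
    refine ⟨fun y => ((hf₁ y).union (hf₂ y)).subset ?_, C₁ + C₂, by positivity, fun x => ?_⟩
    · intro h hh
      by_contra hc
      simp only [Set.mem_union, Set.mem_ofPred_eq, not_or, not_not] at hc
      exact hh (by simp [hc.1, hc.2])
    · obtain ⟨T₁, hT₁, e₁⟩ := h₁ x
      obtain ⟨T₂, hT₂, e₂⟩ := h₂ x
      refine ⟨T₁ + T₂, (norm_add_le _ _).trans (add_le_add hT₁ hT₂), fun ξ g => ?_⟩
      have : (T₁ + T₂) ξ g = T₁ ξ g + T₂ ξ g := rfl
      rw [this, e₁, e₂, convApply, convApply, convApply, ← Summable.tsum_add]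
      · simp only [Pi.add_apply, add_mul]
      · refine summable_of_hasFiniteSupport ((hf₁ g.1).subset fun h hh => ?_)
        exact left_ne_zero_of_mul hh
      · refine summable_of_hasFiniteSupport ((hf₂ g.1).subset fun h hh => ?_)
        exact left_ne_zero_of_mul hh
  smul_mem' := by
    rintro c f ⟨hf, C, hC, h⟩
    refine ⟨fun y => (hf y).subset fun h hh => right_ne_zero_of_mul hh,
      ‖c‖ * C, by positivity, fun x => ?_⟩
    obtain ⟨T, hT, e⟩ := h x
    refine ⟨c • T, (norm_smul_le c T).trans (mul_le_mul_of_nonneg_left hT (norm_nonneg c)),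
      fun ξ g => ?_⟩
    have : (c • T) ξ g = c * T ξ g := rfl
    rw [this, e, convApply, convApply, ← tsum_mul_left]
    simp only [Pi.smul_apply, smul_eq_mul, mul_assoc]

theorem mem_boundedConv_of_bisection (f : Arr X → ℂ) (U : Set (Arr X))
    (hs : Set.InjOn Arr.src U) (hr : Set.InjOn Arr.tgt U) (hU : ∀ γ, γ ∉ U → f γ = 0)
    (C : ℝ) (hC : ∀ γ, ‖f γ‖ ≤ C) : f ∈ boundedConv X := by
  classical
  have hmem : ∀ γ, f γ ≠ 0 → γ ∈ U := fun γ h => by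
    by_contra hc
    exact h (hU γ hc)
  have huniq : ∀ (y : X) (h h' : RangeFiber y), f h.toArr ≠ 0 → f h'.toArr ≠ 0 → h = h' := by
    rintro y ⟨z, h⟩ ⟨z', h'⟩ hh hh'
    have := hr (hmem _ hh) (hmem _ hh') rfl
    simp only [RangeFiber.toArr, Arr.mk.injEq] at this
    obtain ⟨rfl, -, h3⟩ := this
    obtain rfl := eq_of_heq h3
    rfl
  refine ⟨fun y => Set.Subsingleton.finite fun h hh h' hh' => huniq y h h' hh hh',
    max C 0, le_max_right _ _, fun x => ?_⟩
  let pick : ∀ y : X, RangeFiber y := fun y =>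
    if hy : ∃ h : RangeFiber y, f h.toArr ≠ 0 then hy.choose else ⟨y, 𝟙 y⟩
  have hpick : ∀ (y : X) (h : RangeFiber y), f h.toArr ≠ 0 → h = pick y := by
    intro y h hh
    have hy : ∃ h : RangeFiber y, f h.toArr ≠ 0 := ⟨h, hh⟩
    have : pick y = hy.choose := dif_pos hy
    rw [this]
    exact huniq y _ _ hh hy.choose_spec
  obtain ⟨T, hT, e⟩ := EllTwo.exists_weighted (α := SourceFiber x) (β := SourceFiber x)
    (fun g => ⟨(pick g.1).1, g.2 ≫ Groupoid.inv (pick g.1).2⟩) (fun g => f (pick g.1).toArr)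
    (max C 0) (le_max_right _ _) (by
      rintro ⟨y, g⟩ hg ⟨y', g'⟩ hg' heq
      change f (pick y).toArr ≠ 0 at hg
      change f (pick y').toArr ≠ 0 at hg'
      change (⟨(pick y).1, g ≫ Groupoid.inv (pick y).2⟩ : SourceFiber x) =
        ⟨(pick y').1, g' ≫ Groupoid.inv (pick y').2⟩ at heq
      generalize hp : pick y = p at *
      generalize hp' : pick y' = p' at *
      clear hp hp'
      obtain ⟨z, h⟩ := p
      obtain ⟨z', h'⟩ := p'
      have h1 : z = z' := congrArg Sigma.fst heq
      have := hs (hmem _ hg) (hmem _ hg') h1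
      simp only [RangeFiber.toArr, Arr.mk.injEq] at this
      obtain ⟨rfl, rfl, h3⟩ := this
      obtain rfl := eq_of_heq h3
      simp only [Sigma.mk.injEq, heq_eq_eq, true_and] at heq
      have := (cancel_mono (Groupoid.inv h)).1 heq
      rw [this])
    (fun g => (hC _).trans (le_max_left _ _))
  refine ⟨T, hT, fun ξ g => ?_⟩
  rw [e, convApply, tsum_eq_single (pick g.1)]
  intro h hh
  by_cases h0 : f h.toArr = 0
  · rw [h0, zero_mul]
  · exact absurd (hpick _ _ h0) hh

theorem mem_boundedConv_of_finite (t : Set (Set (Arr X))) (ht : t.Finite)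
    (hb : ∀ U ∈ t, Set.InjOn Arr.src U ∧ Set.InjOn Arr.tgt U) (C : ℝ) :
    ∀ f : Arr X → ℂ, (∀ γ, γ ∉ ⋃₀ t → f γ = 0) → (∀ γ, ‖f γ‖ ≤ C) → f ∈ boundedConv X := by
  classical
  induction t, ht using Set.Finite.induction_on with
  | empty =>
    intro f hf _
    have : f = 0 := funext fun γ => hf γ (by simp)
    rw [this]
    exact zero_mem _
  | @insert U t _ _ ih =>
    intro f hf hC
    have hsum : f = U.indicator f + Uᶜ.indicator f := (Set.indicator_self_add_compl U f).symm
    rw [hsum]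
    refine add_mem ?_ ?_
    · refine mem_boundedConv_of_bisection _ U (hb U (by simp)).1 (hb U (by simp)).2
        (fun γ hγ => by simp [hγ]) C fun γ => ?_
      exact (norm_indicator_le_norm_self _ _).trans (hC γ)
    · refine ih (fun V hV => hb V (by simp [hV])) _ (fun γ hγ => ?_) fun γ => ?_
      · by_cases hU : γ ∈ U
        · simp [hU]
        · simp only [Set.mem_compl_iff, hU, not_false_eq_true, Set.indicator_of_mem]
          refine hf γ ?_
          rw [Set.sUnion_insert]
          simp only [Set.mem_union, not_or]
          exact ⟨hU, hγ⟩
      · exact (norm_indicator_le_norm_self _ _).trans (hC γ)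

theorem Cc_le_boundedConv (X : Type*) [Groupoid X] [TopologicalSpace (Arr X)]
    [HasOpenBisections X] : Cc X ≤ boundedConv X := by
  refine Submodule.span_le.2 ?_
  rintro f ⟨V, -, -, hf, K, hKV, hK, h0⟩
  choose W hW hγW hs hr using HasOpenBisections.exists_bisection (X := X)
  obtain ⟨t, _, htK⟩ := hK.elim_nhds_subcover W
    (fun γ _ => (hW γ).mem_nhds (hγW γ))
  obtain ⟨C, hC⟩ := hK.exists_bound_of_continuousOn (hf.mono hKV)
  refine mem_boundedConv_of_finite (W '' (t : Set (Arr X))) (t.finite_toSet.image _)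
    ?_ (max C 0) f (fun γ hγ => h0 γ fun hc => hγ ?_) fun γ => ?_
  · rintro _ ⟨γ, -, rfl⟩
    exact ⟨hs γ, hr γ⟩
  · have := htK hc
    simp only [Set.mem_iUnion] at this
    obtain ⟨δ, hδ, h⟩ := this
    exact ⟨W δ, ⟨δ, hδ, rfl⟩, h⟩
  · by_cases hγ : γ ∈ K
    · exact (hC γ hγ).trans (le_max_left _ _)
    · simp [h0 γ hγ]

end RegularRepresentations

section ReducedCStar

variable {X : Type*} [Groupoid X] [TopologicalSpace (Arr X)] [HasOpenBisections X]

theorem exists_rho (x : X) (f : Cc X) :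
    ∃ T : EllTwo (SourceFiber x) →L[ℂ] EllTwo (SourceFiber x),
      ∀ ξ g, T ξ g = convApply (f : Arr X → ℂ) ξ g := by
  obtain ⟨-, C, -, h⟩ := Cc_le_boundedConv X f.2
  obtain ⟨T, -, e⟩ := h x
  exact ⟨T, e⟩

/-- The operator `ρ_x(f)` on `ℓ²(𝒢_x)`, for `f ∈ C_c(𝒢)`. -/
def rho (x : X) (f : Cc X) : EllTwo (SourceFiber x) →L[ℂ] EllTwo (SourceFiber x) :=
  (exists_rho x f).choose

theorem rho_apply (x : X) (f : Cc X) (ξ : EllTwo (SourceFiber x)) (g : SourceFiber x) :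
    rho x f ξ g = ∑' h : RangeFiber g.1,
      (f : Arr X → ℂ) ⟨h.1, g.1, h.2⟩ * ξ ⟨h.1, g.2 ≫ Groupoid.inv h.2⟩ :=
  (exists_rho x f).choose_spec ξ g

variable (X) in
/-- The C*-algebra `∏_x B(ℓ²(𝒢_x))`. -/
abbrev ProdB : Type _ := BoundedFamilies fun x : X => EllTwo (SourceFiber x)

/-- The family `(ρ_x(f))_x`. Its norm is the reduced norm `‖f‖_r = sup_x ‖ρ_x(f)‖`. -/
def regRep (f : Cc X) : ProdB X :=
  BoundedFamilies.mk (fun x => rho x f) <| by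
    obtain ⟨-, C, -, h⟩ := Cc_le_boundedConv X f.2
    refine ⟨C, ?_⟩
    rintro _ ⟨x, rfl⟩
    obtain ⟨T, hT, e⟩ := h x
    have : rho x f = T := ContinuousLinearMap.ext fun ξ => lp.ext <| funext fun g => by
      rw [e]
      exact rho_apply x f ξ g
    simpa only [this] using hT

theorem norm_regRep (f : Cc X) : ‖regRep f‖ = ⨆ x : X, ‖rho x f‖ := BoundedFamilies.norm_eq_iSup _

variable (X) in
/-- The reduced groupoid C*-algebra `C*_r(𝒢)`: the completion of `C_c(𝒢)` in the reduced norm,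
realized as the closure of the image of `C_c(𝒢)` under the isometric representation
`f ↦ (ρ_x(f))_x`. (In an étale groupoid this image is already a `*`-algebra, the product and
involution being convolution and `f*(g) = conj f(g⁻¹)`, so that `adjoin` adds no elements.) -/
def reducedCStar : NonUnitalStarSubalgebra ℂ (ProdB X) :=
  (NonUnitalStarAlgebra.adjoin ℂ (Set.range (regRep (X := X)))).topologicalClosure

/-- The representation `ρ_x` of `C*_r(𝒢)` on `ℓ²(𝒢_x)`: the continuous extension of `ρ_x` from
`C_c(𝒢)`. -/
def reducedRho (x : X) :
    reducedCStar X →⋆ₙₐ[ℂ] (EllTwo (SourceFiber x) →L[ℂ] EllTwo (SourceFiber x)) :=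
  (BoundedFamilies.eval x).comp (NonUnitalStarSubalgebraClass.subtype (reducedCStar X))

end ReducedCStar

/-- The reduction of a groupoid to a set `A` of units: all arrows with source and range in `A`. -/
@[ext] structure Reduction {X : Type*} (A : Set X) where
  /-- the unit -/
  val : X
  property : val ∈ A

instance Reduction.instGroupoid {X : Type*} [Groupoid X] (A : Set X) : Groupoid (Reduction A) where
  Hom x y := x.1 ⟶ y.1
  id x := 𝟙 x.1
  comp f g := f ≫ g
  id_comp f := Category.id_comp (f : _ ⟶ _)
  comp_id f := Category.comp_id (f : _ ⟶ _)
  assoc f g h := Category.assoc (f : _ ⟶ _) g h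
  inv f := Groupoid.inv f
  inv_comp f := Groupoid.inv_comp (f : _ ⟶ _)
  comp_inv f := Groupoid.comp_inv (f : _ ⟶ _)

/-- The inclusion of the reduction into the groupoid. -/
def Reduction.incl {X : Type*} [Groupoid X] (A : Set X) (γ : Arr (Reduction A)) : Arr X :=
  ⟨γ.src.1, γ.tgt.1, γ.hom⟩

/-- The reduction carries the subspace topology. -/
instance Reduction.instTopologicalSpace {X : Type*} [Groupoid X] [TopologicalSpace (Arr X)]
    (A : Set X) : TopologicalSpace (Arr (Reduction A)) :=
  TopologicalSpace.induced (Reduction.incl A) inferInstance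

theorem Reduction.incl_injective {X : Type*} [Groupoid X] (A : Set X) :
    Function.Injective (Reduction.incl A) := by
  rintro ⟨⟨x, hx⟩, ⟨y, hy⟩, f⟩ ⟨⟨x', hx'⟩, ⟨y', hy'⟩, f'⟩ h
  simp only [Reduction.incl, Arr.mk.injEq] at h
  obtain ⟨rfl, rfl, h⟩ := h
  obtain rfl := eq_of_heq h
  rfl

instance Reduction.instHasOpenBisections {X : Type*} [Groupoid X] [TopologicalSpace (Arr X)]
    [HasOpenBisections X] (A : Set X) : HasOpenBisections (Reduction A) where
  exists_bisection γ := by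
    obtain ⟨U, hU, hγ, hs, hr⟩ := HasOpenBisections.exists_bisection (Reduction.incl A γ)
    refine ⟨Reduction.incl A ⁻¹' U, ⟨U, hU, rfl⟩, hγ, fun δ hδ δ' hδ' h => ?_,
      fun δ hδ δ' hδ' h => ?_⟩
    · exact Reduction.incl_injective A (hs hδ hδ' (congrArg Reduction.val h))
    · exact Reduction.incl_injective A (hr hδ hδ' (congrArg Reduction.val h))

/-! ## The left inverse hull of a left cancellative monoid -/

section Monoid

variable (S : Type*) [Monoid S] [IsLeftCancelMul S]

variable {S} in
open scoped Classical in
/-- The left translation `S → sS`, `t ↦ st`, as a partial bijection of `S`. -/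
def leftTranslation (s : S) : S ≃. S where
  toFun t := some (s * t)
  invFun u := if h : ∃ t, s * t = u then some h.choose else none
  inv t u := by
    constructor
    · intro h
      split_ifs at h with hu
      obtain rfl := Option.some.inj h
      exact congrArg some hu.choose_spec
    · intro h
      have hu : ∃ t, s * t = u := ⟨t, Option.some.inj h⟩
      rw [dif_pos hu]
      exact congrArg some (mul_left_cancel (hu.choose_spec.trans (Option.some.inj h).symm))

variable {S} in
/-- The partial bijections generated by the left translations under composition and inversion. -/
inductive InLeftInverseHull : (S ≃. S) → Prop
  | translation (s : S) : InLeftInverseHull (leftTranslation s)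
  | symm {f : S ≃. S} : InLeftInverseHull f → InLeftInverseHull f.symm
  | trans {f g : S ≃. S} : InLeftInverseHull f → InLeftInverseHull g →
      InLeftInverseHull (f.trans g)

/-- The left inverse hull `I_ℓ(S)`. -/
@[ext] structure LeftInverseHull where
  /-- the partial bijection -/
  val : S ≃. S
  property : InLeftInverseHull val

namespace LeftInverseHull

variable {S}

theorem leftTranslation_one : leftTranslation (1 : S) = PEquiv.refl S :=
  PEquiv.ext fun t => congrArg some (one_mul t)

/-- The product `gh` is the composition "first `h`, then `g`". -/
instance : Monoid (LeftInverseHull S) where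
  mul g h := ⟨h.1.trans g.1, h.2.trans g.2⟩
  one := ⟨PEquiv.refl S, leftTranslation_one (S := S) ▸ InLeftInverseHull.translation 1⟩
  mul_assoc f g h := LeftInverseHull.ext (PEquiv.trans_assoc h.1 g.1 f.1).symm
  one_mul f := LeftInverseHull.ext (PEquiv.trans_refl f.1)
  mul_one f := LeftInverseHull.ext (PEquiv.refl_trans f.1)

instance : InvolutiveInv (LeftInverseHull S) where
  inv g := ⟨g.1.symm, g.2.symm⟩
  inv_inv _ := rfl

/-- The left translation by `s` as an element of `I_ℓ(S)`. -/
def of (s : S) : LeftInverseHull S := ⟨leftTranslation s, .translation s⟩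

theorem mul_apply (g h : LeftInverseHull S) (s : S) : (g * h).1 s = (h.1 s).bind g.1 := rfl

theorem inv_mul_rev (g h : LeftInverseHull S) : (g * h)⁻¹ = h⁻¹ * g⁻¹ := rfl

theorem mul_inv_mul (g : LeftInverseHull S) : g * (g⁻¹ * g) = g := by
  refine LeftInverseHull.ext (PEquiv.ext fun s => ?_)
  change (((g.1 s).bind g.1.symm).bind g.1) = g.1 s
  cases h : g.1 s with
  | none => rfl
  | some t =>
    have : g.1.symm t = some s := (PEquiv.eq_some_iff _).2 h
    simp [this, h]

theorem eq_of_idem {p : LeftInverseHull S} (hp : p * p = p) {s t : S} (h : p.1 s = some t) :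
    t = s := by
  have h1 : (p.1 s).bind p.1 = p.1 s := congrArg (fun q : LeftInverseHull S => q.1 s) hp
  rw [h] at h1
  exact p.1.inj (b := t) h1 h

theorem idem_comm {p q : LeftInverseHull S} (hp : p * p = p) (hq : q * q = q) :
    p * q = q * p := by
  refine LeftInverseHull.ext (PEquiv.ext fun s => ?_)
  rw [mul_apply, mul_apply]
  cases h : q.1 s with
  | none =>
    cases h' : p.1 s with
    | none => rfl
    | some t => rw [eq_of_idem hp h', Option.bind_some, h]; rfl
  | some t =>
    rw [eq_of_idem hq h, Option.bind_some]
    cases h' : p.1 s with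
    | none => rfl
    | some t => rw [eq_of_idem hp h', Option.bind_some, h, eq_of_idem hq h]

theorem idem_inv {p : LeftInverseHull S} (hp : p * p = p) : p⁻¹ = p := by
  refine LeftInverseHull.ext (PEquiv.ext fun s => ?_)
  change p.1.symm s = p.1 s
  refine Option.ext fun t => ?_
  rw [PEquiv.eq_some_iff]
  constructor <;> intro h
  · obtain rfl := eq_of_idem hp h
    exact h
  · obtain rfl := eq_of_idem hp h
    exact h

end LeftInverseHull

open LeftInverseHull

/-- The semigroup `E(S)` of idempotents of `I_ℓ(S)`. -/
@[ext] structure Idem where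
  /-- the element of `I_ℓ(S)` -/
  val : LeftInverseHull S
  property : val * val = val

namespace Idem

variable {S}

instance : Mul (Idem S) where
  mul p q := ⟨p.1 * q.1, by
    rw [mul_assoc, ← mul_assoc q.1, idem_comm q.2 p.2, mul_assoc p.1 q.1, q.2, ← mul_assoc, p.2]⟩

/-- The idempotent `p_S`. -/
instance : One (Idem S) := ⟨⟨1, mul_one 1⟩⟩

/-- The idempotent `g⁻¹g`, the identity map on the domain of `g`. -/
def dom (g : LeftInverseHull S) : Idem S := ⟨g⁻¹ * g, by rw [mul_assoc, mul_inv_mul]⟩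

theorem dom_comm (g : LeftInverseHull S) (p : Idem S) : g⁻¹ * g * p.1 = p.1 * (g⁻¹ * g) :=
  idem_comm (dom g).2 p.2

/-- The idempotent `g⁻¹pg`. -/
def conj (g : LeftInverseHull S) (p : Idem S) : Idem S := ⟨g⁻¹ * p.1 * g, by
  have h : g * g⁻¹ * p.1 = p.1 * (g * g⁻¹) := dom_comm g⁻¹ p
  calc g⁻¹ * p.1 * g * (g⁻¹ * p.1 * g) = g⁻¹ * p.1 * (g * g⁻¹ * p.1) * g := by
        simp only [mul_assoc]
    _ = g⁻¹ * (p.1 * p.1) * (g * (g⁻¹ * g)) := by rw [h]; simp only [mul_assoc]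
    _ = g⁻¹ * p.1 * g := by rw [p.2, mul_inv_mul]⟩

theorem conj_mul (g : LeftInverseHull S) (p q : Idem S) : conj g (p * q) = conj g p * conj g q := by
  refine Idem.ext ?_
  have h : g * g⁻¹ * q.1 = q.1 * (g * g⁻¹) := dom_comm g⁻¹ q
  change g⁻¹ * (p.1 * q.1) * g = g⁻¹ * p.1 * g * (g⁻¹ * q.1 * g)
  calc g⁻¹ * (p.1 * q.1) * g = g⁻¹ * p.1 * q.1 * (g * (g⁻¹ * g)) := by
        rw [mul_inv_mul]; simp only [mul_assoc]
    _ = g⁻¹ * p.1 * (q.1 * (g * g⁻¹)) * g := by simp only [mul_assoc]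
    _ = _ := by rw [← h]; simp only [mul_assoc]

theorem conj_conj (g h : LeftInverseHull S) (p : Idem S) :
    conj g (conj h p) = conj (h * g) p :=
  Idem.ext (by
    change g⁻¹ * (h⁻¹ * p.1 * h) * g = (h * g)⁻¹ * p.1 * (h * g)
    rw [inv_mul_rev]; simp only [mul_assoc])

theorem conj_dom (g h : LeftInverseHull S) : conj g (dom h) = dom (h * g) :=
  Idem.ext (by
    change g⁻¹ * (h⁻¹ * h) * g = (h * g)⁻¹ * (h * g)
    rw [inv_mul_rev]; simp only [mul_assoc])

theorem conj_one (g : LeftInverseHull S) : conj g 1 = dom g :=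
  Idem.ext (by change g⁻¹ * 1 * g = g⁻¹ * g; rw [mul_one])

theorem one_mul' (p : Idem S) : 1 * p = p := Idem.ext (one_mul p.1)

theorem one_conj (p : Idem S) : conj 1 p = p :=
  Idem.ext (by
    change (1 : LeftInverseHull S)⁻¹ * p.1 * 1 = p.1
    rw [idem_inv (mul_one 1), one_mul, mul_one])

theorem conj_inv_conj (g : LeftInverseHull S) (p : Idem S) :
    conj g (conj g⁻¹ p) = dom g * p := by
  refine Idem.ext ?_
  change g⁻¹ * (g⁻¹⁻¹ * p.1 * g⁻¹) * g = g⁻¹ * g * p.1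
  have h := dom_comm g p
  calc g⁻¹ * (g⁻¹⁻¹ * p.1 * g⁻¹) * g = g⁻¹ * g * p.1 * (g⁻¹ * g) := by
        rw [inv_inv]; simp only [mul_assoc]
    _ = g⁻¹ * (g * (g⁻¹ * g)) * p.1 := by rw [mul_assoc (g⁻¹ * g), ← h]; simp only [mul_assoc]
    _ = _ := by rw [mul_inv_mul]

theorem inv_mul_conj (g : LeftInverseHull S) (p : Idem S) :
    g⁻¹ * (conj g⁻¹ p).1 = (g * p.1)⁻¹ := by
  change g⁻¹ * (g⁻¹⁻¹ * p.1 * g⁻¹) = _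
  rw [inv_mul_rev, idem_inv p.2, inv_inv]
  calc g⁻¹ * (g * p.1 * g⁻¹) = (g⁻¹ * g * p.1) * g⁻¹ := by simp only [mul_assoc]
    _ = p.1 * (g⁻¹ * (g⁻¹⁻¹ * g⁻¹)) := by rw [dom_comm, inv_inv]; simp only [mul_assoc]
    _ = _ := by rw [mul_inv_mul]

theorem mul_conj (g : LeftInverseHull S) (q : Idem S) : g * (conj g q).1 = q.1 * g := by
  change g * (g⁻¹ * q.1 * g) = _
  have h : g * g⁻¹ * q.1 = q.1 * (g * g⁻¹) := dom_comm g⁻¹ q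
  calc g * (g⁻¹ * q.1 * g) = g * g⁻¹ * q.1 * g := by simp only [mul_assoc]
    _ = q.1 * (g * (g⁻¹ * g)) := by rw [h]; simp only [mul_assoc]
    _ = _ := by rw [mul_inv_mul]

end Idem

/-! ## Semi-characters and the Paterson groupoid -/

/-- Semi-characters of `E(S)`: semigroup homomorphisms `E(S) → {0, 1}` that are not identically
zero. -/
@[ext] structure SemiChar where
  /-- the underlying function, `true` being `1` and `false` being `0` -/
  toFun : Idem S → Bool
  map_mul : ∀ p q, toFun (p * q) = (toFun p && toFun q)
  ne_zero : ∃ p, toFun p = true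

namespace SemiChar

variable {S}

instance : CoeFun (SemiChar S) (fun _ => Idem S → Bool) := ⟨toFun⟩

/-- The topology of pointwise convergence. -/
instance : TopologicalSpace (SemiChar S) := TopologicalSpace.induced toFun inferInstance

theorem map_one (χ : SemiChar S) : χ 1 = true := by
  obtain ⟨p, hp⟩ := χ.ne_zero
  rw [← Idem.one_mul' p, χ.map_mul, Bool.and_eq_true] at hp
  exact hp.1

/-- The semi-character `χ_s`, with `χ_s(p_X) = 1` if and only if `s ∈ X`. -/
def point (s : S) : SemiChar S where
  toFun p := (p.1.1 s).isSome
  map_mul p q := by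
    change ((q.1.1 s).bind p.1.1).isSome = _
    cases h : q.1.1 s with
    | none => simp
    | some t => rw [eq_of_idem q.2 h]; simp
  ne_zero := ⟨1, rfl⟩

/-- The elements `g` of `I_ℓ(S)` with `χ(g⁻¹g) = 1` and `χ(g⁻¹ · g) = ψ`. -/
@[ext] structure PreHom (χ ψ : SemiChar S) where
  /-- the element `g` -/
  val : LeftInverseHull S
  property : χ (Idem.dom val) = true ∧ ∀ p, ψ p = χ (Idem.conj val p)

/-- `(g₁, χ) ∼ (g₂, χ)` if `g₁p = g₂p` for some idempotent `p` with `χ(p) = 1`. -/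
instance germSetoid (χ ψ : SemiChar S) : Setoid (PreHom χ ψ) where
  r g h := ∃ p : Idem S, g.1 * p.1 = h.1 * p.1 ∧ χ p = true
  iseqv :=
    { refl := fun _ => ⟨1, rfl, χ.map_one⟩
      symm := fun ⟨p, h, hp⟩ => ⟨p, h.symm, hp⟩
      trans := by
        rintro f g h ⟨p, h1, hp⟩ ⟨q, h2, hq⟩
        refine ⟨p * q, ?_, by rw [χ.map_mul, hp, hq]; rfl⟩
        change f.1 * (p.1 * q.1) = h.1 * (p.1 * q.1)
        rw [← mul_assoc, h1, idem_comm p.2 q.2, ← mul_assoc h.1, ← h2, mul_assoc, mul_assoc,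
          idem_comm p.2 q.2] }

/-- The arrows `[g, χ]` from `χ` to `ψ`. -/
def Germ (χ ψ : SemiChar S) : Type _ := Quotient (germSetoid χ ψ)

namespace PreHom

variable {χ ψ θ : SemiChar S}

/-- the identity representative -/
def id (χ : SemiChar S) : PreHom χ χ := ⟨1, by
  refine ⟨?_, fun p => by rw [Idem.one_conj]⟩
  rw [← Idem.conj_one, Idem.one_conj]
  exact χ.map_one⟩

/-- `(h, ψ) (g, χ) = (hg, χ)` for `ψ = χ(g⁻¹ · g)` -/
def comp (g : PreHom χ ψ) (h : PreHom ψ θ) : PreHom χ θ := ⟨h.1 * g.1, by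
  refine ⟨?_, fun p => ?_⟩
  · rw [← Idem.conj_dom, ← g.2.2]
    exact h.2.1
  · rw [← Idem.conj_conj, ← g.2.2, h.2.2]⟩

theorem src_eq (g : PreHom χ ψ) (p : Idem S) : χ p = ψ (Idem.conj g.1⁻¹ p) := by
  rw [g.2.2, Idem.conj_inv_conj, χ.map_mul, g.2.1, Bool.true_and]

/-- `(g, χ)⁻¹ = (g⁻¹, χ(g⁻¹ · g))` -/
def inv (g : PreHom χ ψ) : PreHom ψ χ := ⟨g.1⁻¹, by
  refine ⟨?_, g.src_eq⟩
  have h : Idem.conj g.1 (Idem.dom g.1⁻¹) = Idem.dom g.1 := by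
    rw [Idem.conj_dom]
    refine Idem.ext ?_
    change (g.1⁻¹ * g.1)⁻¹ * (g.1⁻¹ * g.1) = g.1⁻¹ * g.1
    rw [show (g.1⁻¹ * g.1)⁻¹ = g.1⁻¹ * g.1 from idem_inv (Idem.dom g.1).2]
    exact (Idem.dom g.1).2
  rw [g.2.2, h]
  exact g.2.1⟩

theorem comp_congr (g g' : PreHom χ ψ) (hg : g ≈ g') (h h' : PreHom ψ θ) (hh : h ≈ h') :
    comp g h ≈ comp g' h' := by
  obtain ⟨p, h1, hp⟩ := hg
  obtain ⟨q, h2, hq⟩ := hh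
  refine ⟨p * Idem.conj g.1 q, ?_, by rw [χ.map_mul, hp, ← g.2.2, hq]; rfl⟩
  have hc : p.1 * (Idem.conj g.1 q).1 = (Idem.conj g.1 q).1 * p.1 :=
    idem_comm p.2 (Idem.conj g.1 q).2
  have key : g.1 * (p.1 * (Idem.conj g.1 q).1) = q.1 * (g.1 * p.1) := by
    rw [hc, ← mul_assoc, Idem.mul_conj, mul_assoc]
  change h.1 * g.1 * (p.1 * (Idem.conj g.1 q).1) = h'.1 * g'.1 * (p.1 * (Idem.conj g.1 q).1)
  rw [mul_assoc, key, mul_assoc h'.1, ← mul_assoc g'.1, ← h1, mul_assoc g.1, key, ← mul_assoc,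
    h2, mul_assoc]

theorem inv_congr (g g' : PreHom χ ψ) (hg : g ≈ g') : inv g ≈ inv g' := by
  obtain ⟨p, h1, hp⟩ := hg
  refine ⟨Idem.conj g.1⁻¹ p, ?_, by rw [← g.src_eq, hp]⟩
  have hq : Idem.conj g.1⁻¹ p = Idem.conj g'.1⁻¹ p := by
    have key : ∀ k : LeftInverseHull S, (Idem.conj k⁻¹ p).1 = (k * p.1) * (k * p.1)⁻¹ := by
      intro k
      change k⁻¹⁻¹ * p.1 * k⁻¹ = _
      rw [inv_mul_rev, idem_inv p.2, inv_inv, mul_assoc k p.1 (p.1 * _), ← mul_assoc p.1, p.2, mul_assoc]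
    refine Idem.ext ?_
    rw [key, key, h1]
  change g.1⁻¹ * (Idem.conj g.1⁻¹ p).1 = g'.1⁻¹ * (Idem.conj g.1⁻¹ p).1
  rw [Idem.inv_mul_conj, hq, Idem.inv_mul_conj, h1]

end PreHom

/-- The Paterson groupoid `𝒢(I_ℓ(S))` with unit space the semi-characters of `E(S)`. -/
instance : Groupoid (SemiChar S) where
  Hom χ ψ := Germ χ ψ
  id χ := Quotient.mk _ (PreHom.id χ)
  comp := Quotient.map₂ PreHom.comp fun g g' hg h h' hh => PreHom.comp_congr g g' hg h h' hh
  id_comp := by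
    rintro _ _ ⟨g⟩
    exact Quotient.sound ⟨1, congrArg (· * _) (mul_one g.1), SemiChar.map_one _⟩
  comp_id := by
    rintro _ _ ⟨g⟩
    exact Quotient.sound ⟨1, congrArg (· * _) (one_mul g.1), SemiChar.map_one _⟩
  assoc := by
    rintro _ _ _ _ ⟨f⟩ ⟨g⟩ ⟨h⟩
    exact Quotient.sound ⟨1, congrArg (· * _) (mul_assoc h.1 g.1 f.1).symm, SemiChar.map_one _⟩
  inv := Quotient.map PreHom.inv PreHom.inv_congr
  inv_comp := by
    rintro χ ψ ⟨g⟩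
    refine Quotient.sound ⟨Idem.dom g.1⁻¹, ?_, (PreHom.inv g).2.1⟩
    change g.1 * g.1⁻¹ * (Idem.dom g.1⁻¹).1 = 1 * (Idem.dom g.1⁻¹).1
    rw [one_mul]
    exact (Idem.dom g.1⁻¹).2
  comp_inv := by
    rintro χ ψ ⟨g⟩
    refine Quotient.sound ⟨Idem.dom g.1, ?_, g.2.1⟩
    change g.1⁻¹ * g.1 * (Idem.dom g.1).1 = 1 * (Idem.dom g.1).1
    rw [one_mul]
    exact (Idem.dom g.1).2

/-- The set `D(g, U)` of arrows of the form `[g, χ]` with `χ ∈ U`. -/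
def basicSet (g : LeftInverseHull S) (U : Set (SemiChar S)) : Set (Arr (SemiChar S)) :=
  {γ | γ.src ∈ U ∧ ∃ hg, γ.hom = Quotient.mk (germSetoid γ.src γ.tgt) ⟨g, hg⟩}

/-- The topology of the Paterson groupoid, with basis the sets `D(g, U)`, where `U` is an open
subset of `{χ | χ(g⁻¹g) = 1}`. -/
instance : TopologicalSpace (Arr (SemiChar S)) :=
  TopologicalSpace.generateFrom {D | ∃ (g : LeftInverseHull S) (U : Set (SemiChar S)),
    IsOpen U ∧ U ⊆ {χ | χ (Idem.dom g) = true} ∧ D = basicSet g U}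

theorem continuous_eval (p : Idem S) : Continuous fun χ : SemiChar S => χ p :=
  (continuous_apply p).comp continuous_induced_dom

instance : HasOpenBisections (SemiChar S) where
  exists_bisection := by
    rintro ⟨χ, ψ, ⟨g⟩⟩
    refine ⟨basicSet g.1 {χ | χ (Idem.dom g.1) = true}, ?_, ⟨g.2.1, g.2, rfl⟩, ?_, ?_⟩
    · refine TopologicalSpace.isOpen_generateFrom_of_mem ⟨_, _, ?_, subset_rfl, rfl⟩
      exact (isOpen_discrete {true}).preimage (continuous_eval (Idem.dom g.1))
    · rintro ⟨χ₁, ψ₁, _⟩ ⟨-, h₁, e₁⟩ ⟨χ₂, ψ₂, _⟩ ⟨-, h₂, e₂⟩ h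
      dsimp only at h h₁ h₂ e₁ e₂
      subst h
      have : ψ₁ = ψ₂ := SemiChar.ext (funext fun p => by rw [h₁.2, h₂.2])
      subst this
      rw [e₁, e₂]
    · rintro ⟨χ₁, ψ₁, _⟩ ⟨-, h₁, e₁⟩ ⟨χ₂, ψ₂, _⟩ ⟨-, h₂, e₂⟩ h
      dsimp only at h h₁ h₂ e₁ e₂
      subst h
      have : χ₁ = χ₂ := SemiChar.ext (funext fun p => by
        rw [PreHom.src_eq ⟨_, h₁⟩, PreHom.src_eq ⟨_, h₂⟩])
      subst this
      rw [e₁, e₂]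

end SemiChar

/-- The set `Ω(S)`: the closure of the orbit of `χ_e` under the Paterson groupoid. -/
def Omega : Set (SemiChar S) := closure {χ | Nonempty (SemiChar.point (1 : S) ⟶ χ)}

/-- The groupoid `𝒢_P(S)`: the reduction of the Paterson groupoid of `I_ℓ(S)` to `Ω(S)`. -/
abbrev GroupoidP : Type _ := Reduction (Omega S)

/-- The unit `χ_e` of `𝒢_P(S)`. -/
def chiE : GroupoidP S := ⟨SemiChar.point 1, subset_closure ⟨𝟙 _⟩⟩

variable {S}

theorem translation_conj (s : S) (p : Idem S) :
    SemiChar.point s p = SemiChar.point (1 : S) (Idem.conj (of s) p) := by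
  have hs : (of s).1 1 = some s := congrArg some (mul_one s)
  have hs' : (of s)⁻¹.1 s = some 1 := (PEquiv.eq_some_iff _).2 hs
  change (p.1.1 s).isSome = (((of s).1 1).bind fun t => (p.1.1 t).bind (of s)⁻¹.1).isSome
  rw [hs, Option.bind_some]
  cases h : p.1.1 s with
  | none => rfl
  | some t => rw [eq_of_idem p.2 h, Option.bind_some, hs']; rfl

theorem point_dom_of (s : S) : SemiChar.point (1 : S) (Idem.dom (of s)) = true := by
  rw [← Idem.conj_one, ← translation_conj]
  exact SemiChar.map_one _

/-- The arrow `[s, χ_e]` of the Paterson groupoid, which goes from `χ_e` to `χ_s`. -/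
def translationGerm (s : S) : SemiChar.point (1 : S) ⟶ SemiChar.point s :=
  Quotient.mk (SemiChar.germSetoid _ _) ⟨of s, point_dom_of s, translation_conj s⟩

/-- The arrow `[s, χ_e]` as an element of the source fiber of `χ_e` in `𝒢_P(S)`. -/
def toFiber (s : S) : SourceFiber (chiE S) :=
  ⟨⟨SemiChar.point s, subset_closure ⟨translationGerm s⟩⟩, translationGerm s⟩

/-- Elements of `I_ℓ(S)` are partial maps of right `S`-sets. -/
theorem InLeftInverseHull.equivariant {f : S ≃. S} (hf : InLeftInverseHull f) :
    ∀ {s t : S}, f s = some t → ∀ u, f (s * u) = some (t * u) := by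
  suffices h : ∀ {s t : S}, (f s = some t → ∀ u, f (s * u) = some (t * u)) ∧
      (f.symm s = some t → ∀ u, f.symm (s * u) = some (t * u)) from
    fun {s t} => (@h s t).1
  induction hf with
  | translation s =>
    intro t v
    have key : ∀ {t v : S}, leftTranslation s t = some v → ∀ u,
        leftTranslation s (t * u) = some (v * u) := by
      intro t v h u
      obtain rfl := Option.some.inj h
      exact congrArg some (mul_assoc s t u).symm
    refine ⟨key, fun h u => ?_⟩
    rw [PEquiv.eq_some_iff] at h ⊢
    exact key h u
  | symm _ ih => intro s t; exact ⟨ih.2, ih.1⟩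
  | @trans f g _ _ ihf ihg =>
    intro s t
    constructor
    · intro h u
      obtain ⟨v, h1, h2⟩ := (PEquiv.trans_eq_some f g s t).1 h
      exact (PEquiv.trans_eq_some f g _ _).2 ⟨v * u, ihf.1 h1 u, ihg.1 h2 u⟩
    · intro h u
      rw [PEquiv.symm_trans_rev] at h ⊢
      obtain ⟨v, h1, h2⟩ := (PEquiv.trans_eq_some g.symm f.symm s t).1 h
      exact (PEquiv.trans_eq_some g.symm f.symm _ _).2 ⟨v * u, ihg.2 h1 u, ihf.2 h2 u⟩

theorem toFiber_bijective : Function.Bijective (toFiber (S := S)) := by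
  constructor
  · intro s t h
    have hψ : SemiChar.point s = SemiChar.point t :=
      congrArg (fun x : SourceFiber (chiE S) => x.1.1) h
    have key : ∀ (x y : GroupoidP S) (g : chiE S ⟶ x) (k : chiE S ⟶ y),
        (⟨x, g⟩ : SourceFiber (chiE S)) = ⟨y, k⟩ → ∀ (g₀ : SemiChar.PreHom _ x.1)
        (k₀ : SemiChar.PreHom _ y.1), g = Quotient.mk (SemiChar.germSetoid _ _) g₀ →
        k = Quotient.mk (SemiChar.germSetoid _ _) k₀ → g₀.1.1 1 = k₀.1.1 1 := by
      intro x y g k h g₀ k₀ hg hk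
      obtain rfl : x = y := congrArg Sigma.fst h
      obtain rfl : g = k := by simpa using h
      obtain ⟨p, hp, h1⟩ := Quotient.exact (hg.symm.trans hk)
      obtain ⟨u, hu⟩ := Option.isSome_iff_exists.1 (show (p.1.1 1).isSome = true from h1)
      have hp1 : p.1.1 1 = some 1 := by rw [hu, eq_of_idem p.2 hu]
      have := congrArg (fun q : LeftInverseHull S => q.1 1) hp
      simpa [mul_apply, hp1] using this
    have := key _ _ _ _ h _ _ rfl rfl
    have h2 : some (s * 1) = some (t * 1) := this
    simpa using h2
  · rintro ⟨⟨ψ, hψ⟩, ⟨g⟩⟩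
    have hdom : (((g.1.1 1).bind g.1⁻¹.1)).isSome = true := g.2.1
    obtain ⟨s, hs⟩ : ∃ s, g.1.1 1 = some s := by
      cases h : g.1.1 1 with
      | none => simp [h] at hdom
      | some s => exact ⟨s, rfl⟩
    have hg : g.1 = of s := LeftInverseHull.ext (PEquiv.ext fun t => by
      have := g.1.2.equivariant hs t
      rw [one_mul] at this
      exact this)
    refine ⟨s, ?_⟩
    obtain ⟨g, hg1⟩ := g
    dsimp only at hg
    subst hg
    have : SemiChar.point s = ψ := SemiChar.ext (funext fun p => by
      rw [translation_conj]
      exact (hg1.2 p).symm)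
    subst this
    rfl

variable (S) in
/-- The bijection `S ≅ 𝒢_P(S)_{χ_e}`, `s ↦ [s, χ_e]`. -/
def fiberEquiv : S ≃ SourceFiber (chiE S) := Equiv.ofBijective toFiber toFiber_bijective

/-! ## Strong C*-regularity -/

variable (S) in
open scoped Classical in
/-- The constructible right ideals: the domains of the idempotents in `I_ℓ(S)`, that is, the
subsets `X` of `S` such that the identity map of `X` lies in `I_ℓ(S)`. -/
def constructibleIdeals : Set (Set S) := {X | InLeftInverseHull (PEquiv.ofSet X)}

open scoped Classical in
/-- The idempotent `p_X`, the identity map of the constructible ideal `X`. -/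
def idemOf (X : constructibleIdeals S) : LeftInverseHull S := ⟨PEquiv.ofSet X.1, X.2⟩

variable (S) in
/-- Strong C*-regularity of a left cancellative monoid. -/
def StronglyCStarRegular : Prop :=
  ∀ (n m : ℕ) (h : Fin n → LeftInverseHull S) (X : constructibleIdeals S)
    (Xs : Fin m → constructibleIdeals S),
    (X.1 \ ⋃ i, (Xs i).1).Nonempty →
    X.1 \ ⋃ i, (Xs i).1 ⊆ ⋃ k, {s : S | (h k).1 s = some s} →
    ∃ (l : ℕ) (Y : Fin l → constructibleIdeals S) (k : Fin l → Fin n),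
      X.1 \ ⋃ i, (Xs i).1 ⊆ ⋃ j, (Y j).1 ∧
      ∀ j, h (k j) * idemOf (Y j) = idemOf (Y j)

/-! ## The reduced C*-algebra of the monoid -/

open scoped Classical in
theorem exists_leftRegular (s : S) : ∃ T : EllTwo S →L[ℂ] EllTwo S,
    ∀ t : S, T (lp.single 2 t (1 : ℂ)) = lp.single 2 (s * t) (1 : ℂ) := by
  obtain ⟨T, -, e⟩ := EllTwo.exists_weighted (α := S) (β := S)
    (fun u => if h : ∃ t, s * t = u then h.choose else 1)
    (fun u => if ∃ t, s * t = u then 1 else 0) 1 zero_le_one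
    (by
      intro u hu v hv huv
      have hu' : ∃ t, s * t = u := by
        by_contra hc
        exact hu (if_neg hc)
      have hv' : ∃ t, s * t = v := by
        by_contra hc
        exact hv (if_neg hc)
      simp only [dif_pos hu', dif_pos hv'] at huv
      rw [← hu'.choose_spec, ← hv'.choose_spec, huv])
    (fun u => by split_ifs <;> simp)
  refine ⟨T, fun t => lp.ext (funext fun u => ?_)⟩
  rw [e]
  by_cases hu : ∃ v, s * v = u
  · rw [if_pos hu, dif_pos hu, one_mul]
    have hc := hu.choose_spec
    generalize hu.choose = v at hc
    subst hc
    by_cases hvt : v = t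
    · subst hvt
      simp
    · have : s * v ≠ s * t := fun h => hvt (mul_left_cancel h)
      simp [lp.single_apply, hvt, this]
  · rw [if_neg hu, zero_mul]
    have : u ≠ s * t := fun h => hu ⟨t, h.symm⟩
    simp [lp.single_apply, this]

/-- The operator `λ_s` on `ℓ²(S)`, `λ_s δ_t = δ_{st}`. -/
def leftRegular (s : S) : EllTwo S →L[ℂ] EllTwo S := (exists_leftRegular s).choose

open scoped Classical in
theorem leftRegular_single (s t : S) :
    leftRegular s (lp.single 2 t (1 : ℂ)) = lp.single 2 (s * t) (1 : ℂ) :=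
  (exists_leftRegular s).choose_spec t

variable (S) in
/-- The reduced C*-algebra `C*_r(S)`: the C*-algebra generated by the operators `λ_s`. -/
def monoidReducedCStar : NonUnitalStarSubalgebra ℂ (EllTwo S →L[ℂ] EllTwo S) :=
  (NonUnitalStarAlgebra.adjoin ℂ (Set.range (leftRegular (S := S)))).topologicalClosure

end Monoid

end

/-! The point is that `ρ_{χ_e}` is isometric: `‖ρ_x(a)‖ ≤ ‖ρ_{χ_e}(a)‖` for every `x ∈ Ω(S)`. By
continuity this need only be checked on the span of the characteristic functions `1_g` of the
compact open bisections `{[g, χ]}`.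

In the basis of arrows, `ρ_x(1_g)` has entry 1 at `(k, l)` if the germs of `gk` and `l` at `x`
agree, and 0 otherwise (`entry_ind`). So a finite block of `ρ_x(a)` depends only on finitely many
equalities of germs. At `χ_e` the arrows are the points of `S`, and the equality to test is `g(s) =
t`. Strong C*-regularity yields a point `s ∈ S` at which finitely many representatives are defined
and take equal values exactly when their germs at `x` agree (`exists_separating`). Then `k ↦ k(s)`
realizes the block of `ρ_x(a)` as a block of `ρ_{χ_e}(a)`, and `norm_le_of_blocks` compares the
norms.

Such an `s` is found near `x`, that is, with `χ_s` close to `x`. Equal germs then take equal values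
automatically; the danger is that each such `s` is fixed by one of finitely many elements `h` whose
germs at `x` are not units. In that case regularity covers these `s` by ideals `Y_j` on which some
such `h` is the identity. Since `x` is a limit of characters `χ_s`, some `Y_j` has `x(p_{Y_j}) = 1`,
so that the germ of this `h` is a unit after all (`exists_approx`).

Density of the span of the `1_g` comes from cutting a function in `C_c` along compact open
bisections and applying Stone–Weierstrass on `Ω(S)`. The range is `C*_r(S)` because `1_s` is sent to
`λ_s`, while products and inverses in `I_ℓ(S)` become products and adjoints of operators. -/

noncomputable section

/-! ### Germs of partial bijections, and strong C*-regularity -/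

section LeftInverseHullLemmas

variable {S : Type*} [Monoid S] [IsLeftCancelMul S]

open LeftInverseHull

namespace Idem

theorem apply_of_isSome (p : Idem S) {t : S} (h : (p.1.1 t).isSome = true) :
    p.1.1 t = some t := by
  obtain ⟨u, hu⟩ := Option.isSome_iff_exists.1 h
  rw [hu, eq_of_idem p.2 hu]

theorem isSome_mul (p q : Idem S) (t : S) :
    ((p * q).1.1 t).isSome = ((p.1.1 t).isSome && (q.1.1 t).isSome) :=
  (SemiChar.point t).map_mul p q

theorem isSome_conj {g : LeftInverseHull S} {p : Idem S} {t u : S} (h : g.1 t = some u) :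
    ((conj g p).1.1 t).isSome = (p.1.1 u).isSome := by
  have h' : g.1.symm u = some t := (PEquiv.eq_some_iff _).2 h
  change ((g.1 t).bind fun t => (p.1.1 t).bind g.1.symm).isSome = _
  rw [h, Option.bind_some]
  cases hp : p.1.1 u with
  | none => rfl
  | some v => rw [eq_of_idem p.2 hp, Option.bind_some, h']; rfl

theorem isSome_dom (g : LeftInverseHull S) (t : S) :
    ((dom g).1.1 t).isSome = (g.1 t).isSome := by
  change ((g.1 t).bind g.1.symm).isSome = _
  cases h : g.1 t with
  | none => rfl
  | some u =>
    have h' : g.1.symm u = some t := (PEquiv.eq_some_iff _).2 h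
    rw [Option.bind_some, h']; rfl

theorem isSome_of_isSome_conj {g : LeftInverseHull S} {p : Idem S} {t : S}
    (h : ((conj g p).1.1 t).isSome = true) : ∃ u, g.1 t = some u := by
  change ((g.1 t).bind fun t => (p.1.1 t).bind g.1.symm).isSome = _ at h
  cases hg : g.1 t with
  | none => simp [hg] at h
  | some u => exact ⟨u, rfl⟩

theorem ext_isSome {p q : Idem S} (h : ∀ t, (p.1.1 t).isSome = (q.1.1 t).isSome) : p = q := by
  refine Idem.ext (LeftInverseHull.ext (PEquiv.ext fun t => ?_))
  cases hp : (p.1.1 t).isSome with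
  | true => rw [apply_of_isSome p hp, apply_of_isSome q (h t ▸ hp)]
  | false =>
    have hq := h t ▸ hp
    rw [Option.isSome_eq_false_iff, Option.isNone_iff_eq_none] at hp hq
    rw [hp, hq]

/-- This turns the algebraic relation defining germs into agreement of partial maps on a domain;
being undefined at the same points counts as agreement. -/
theorem mul_idem_eq_iff {g h : LeftInverseHull S} {p : Idem S} :
    g * p.1 = h * p.1 ↔ ∀ t, (p.1.1 t).isSome = true → g.1 t = h.1 t := by
  constructor
  · intro H t ht
    have := congrArg (fun q : LeftInverseHull S => q.1 t) H
    simpa [mul_apply, apply_of_isSome p ht] using this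
  · intro H
    refine LeftInverseHull.ext (PEquiv.ext fun t => ?_)
    rw [mul_apply, mul_apply]
    cases hp : p.1.1 t with
    | none => rfl
    | some u =>
      rw [eq_of_idem p.2 hp, Option.bind_some, Option.bind_some]
      exact H t (by rw [hp]; rfl)

end Idem

namespace SemiChar

/-- Inclusion of domains means `p * q = p`, so multiplicativity makes semi-characters monotone. -/
theorem map_le (χ : SemiChar S) {p q : Idem S}
    (h : ∀ t, (p.1.1 t).isSome = true → (q.1.1 t).isSome = true) (hp : χ p = true) :
    χ q = true := by
  have : p * q = p := Idem.ext_isSome fun t => by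
    rw [Idem.isSome_mul]
    cases hp : (p.1.1 t).isSome with
    | true => rw [h t hp]; rfl
    | false => rfl
  have h2 := χ.map_mul p q
  rw [this, hp, Bool.true_and] at h2
  exact h2.symm

/-- The elements `g` and `h` have the same germ at `χ`. -/
def GermEq (χ : SemiChar S) (g h : LeftInverseHull S) : Prop :=
  ∃ p : Idem S, (∀ t, (p.1.1 t).isSome = true → g.1 t = h.1 t) ∧ χ p = true

/-- `GermEq` does not mention the range of a germ, so arrows can be compared before their ranges are
known to coincide. -/
theorem mk_eq_mk_iff {χ ψ : SemiChar S} {g h : PreHom χ ψ} :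
    (Quotient.mk (germSetoid χ ψ) g = Quotient.mk (germSetoid χ ψ) h) ↔ GermEq χ g.1 h.1 := by
  rw [Quotient.eq]
  exact exists_congr fun p => and_congr_left' Idem.mul_idem_eq_iff

namespace GermEq

variable {χ ψ : SemiChar S} {g h k : LeftInverseHull S}

theorem refl : GermEq χ g g := ⟨1, fun _ _ => rfl, χ.map_one⟩

theorem symm (H : GermEq χ g h) : GermEq χ h g := by
  obtain ⟨p, h1, h2⟩ := H
  exact ⟨p, fun t ht => (h1 t ht).symm, h2⟩

theorem trans (H : GermEq χ g h) (H' : GermEq χ h k) : GermEq χ g k := by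
  obtain ⟨p, h1, h2⟩ := H
  obtain ⟨q, h1', h2'⟩ := H'
  refine ⟨p * q, fun t ht => ?_, by rw [χ.map_mul, h2, h2']; rfl⟩
  rw [Idem.isSome_mul, Bool.and_eq_true] at ht
  rw [h1 t ht.1, h1' t ht.2]

theorem mul_left (k : LeftInverseHull S) (H : GermEq χ g h) : GermEq χ (k * g) (k * h) := by
  obtain ⟨p, h1, h2⟩ := H
  exact ⟨p, fun t ht => by rw [mul_apply, mul_apply, h1 t ht], h2⟩

/-- `GermEq` alone does not say that `χ` lies in the domains; this property passes from one element
to the other because both have the same domain inside that of `p`. -/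
theorem dom (H : GermEq χ g h) (hh : χ (Idem.dom h) = true) : χ (Idem.dom g) = true := by
  obtain ⟨p, h1, h2⟩ := H
  refine χ.map_le (p := p * Idem.dom h) (fun t ht => ?_) (by rw [χ.map_mul, h2, hh]; rfl)
  rw [Idem.isSome_mul, Bool.and_eq_true, Idem.isSome_dom] at ht
  rw [Idem.isSome_dom, h1 t ht.1, ht.2]

/-- Composition on the right with an element sending `χ` to `ψ`. -/
theorem mul_right (k : PreHom χ ψ) (H : GermEq ψ g h) : GermEq χ (g * k.1) (h * k.1) := by
  obtain ⟨p, h1, h2⟩ := H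
  refine ⟨Idem.conj k.1 p, fun t ht => ?_, by rw [← k.2.2, h2]⟩
  obtain ⟨u, hu⟩ := Idem.isSome_of_isSome_conj ht
  rw [Idem.isSome_conj hu] at ht
  rw [mul_apply, mul_apply, hu, Option.bind_some, Option.bind_some, h1 u ht]

theorem inv_mul (hg : χ (Idem.dom g) = true) : GermEq χ (g⁻¹ * g) 1 :=
  ⟨Idem.dom g, fun _ ht => Idem.apply_of_isSome (Idem.dom g) ht, hg⟩

theorem of_dom_mul (h : χ (Idem.dom (g * k)) = true) : χ (Idem.dom k) = true := by
  refine χ.map_le (fun t ht => ?_) h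
  rw [Idem.isSome_dom] at ht ⊢
  rw [mul_apply] at ht
  cases hk : k.1 t with
  | none => simp [hk] at ht
  | some u => rfl

/-- `hk⁻¹` and `g` agree at the range of `k` if and only if `gk` and `h` agree at the source. -/
theorem mul_inv_iff (k : PreHom χ ψ) : GermEq ψ g (h * k.1⁻¹) ↔ GermEq χ (g * k.1) h := by
  constructor
  · intro H
    have := H.mul_right k
    rw [mul_assoc h] at this
    refine this.trans ?_
    simpa using (inv_mul k.2.1).mul_left h
  · intro H
    have := H.mul_right (PreHom.inv k)
    refine GermEq.trans ?_ this
    change GermEq ψ g (g * k.1 * k.1⁻¹)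
    have h2 := (inv_mul (PreHom.inv k).2.1).mul_left g
    rw [mul_one] at h2
    refine h2.symm.trans ?_
    rw [mul_assoc]
    exact GermEq.refl

/-- Moving an element to the other side of a germ equation. -/
theorem eq_inv_mul (hh : χ (Idem.dom h) = true)
    (H : GermEq χ (g * k) h) : GermEq χ (g⁻¹ * h) k := by
  have hd := H.dom hh
  -- Replace `h` by `g * k`; on the domain of `g * k` the factor `g⁻¹ * g` cancels.
  refine (H.symm.mul_left g⁻¹).trans ⟨Idem.dom (g * k), fun t ht => ?_, hd⟩
  rw [Idem.isSome_dom, mul_apply] at ht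
  rw [mul_apply, mul_apply]
  cases hk : k.1 t with
  | none => simp [hk] at ht
  | some u =>
    rw [hk, Option.bind_some] at ht
    obtain ⟨v, hv⟩ := Option.isSome_iff_exists.1 ht
    have hv' : g.1.symm v = some u := (PEquiv.eq_some_iff _).2 hv
    rw [Option.bind_some, hv, Option.bind_some]
    exact hv'

end GermEq

/-- An idempotent with value 1 under `χ_e` is defined at the identity, so germs at `χ_e` can be
evaluated there. Conversely, equivariance forces an element with `g(1) = t` to be left translation
by `t` on all of `S`. -/
theorem germEq_point_one_iff {g : LeftInverseHull S} {t : S} :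
    GermEq (point (1 : S)) g (of t) ↔ g.1 1 = some t := by
  have ht : (of t).1 1 = some t := congrArg some (mul_one t)
  constructor
  · rintro ⟨p, h1, h2⟩
    rw [h1 1 h2, ht]
  · intro H
    refine ⟨1, fun u _ => ?_, map_one _⟩
    have := g.2.equivariant H u
    rw [one_mul] at this
    exact this

end SemiChar

variable (S) in
theorem mem_orbit_iff {χ : SemiChar S} :
    Nonempty (SemiChar.point (1 : S) ⟶ χ) ↔ ∃ s : S, SemiChar.point s = χ := by
  constructor
  · rintro ⟨f⟩
    obtain ⟨s, hs⟩ := toFiber_bijective.2 (⟨⟨χ, subset_closure ⟨f⟩⟩, f⟩ : SourceFiber (chiE S))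
    exact ⟨s, congrArg (fun x : SourceFiber (chiE S) => x.1.1) hs⟩
  · rintro ⟨s, rfl⟩
    exact ⟨translationGerm s⟩

/-- `χ` lies in `Ω(S)` if and only if it can be approximated by the characters `χ_s`. -/
theorem mem_Omega_iff {χ : SemiChar S} :
    χ ∈ Omega S ↔ ∀ F : Finset (Idem S), ∃ s : S, ∀ p ∈ F, (p.1.1 s).isSome = χ p := by
  constructor
  · intro h F
    have ho : IsOpen {ψ : SemiChar S | ∀ p ∈ F, ψ p = χ p} := by
      have : {ψ : SemiChar S | ∀ p ∈ F, ψ p = χ p} = ⋂ p ∈ F, {ψ : SemiChar S | ψ p = χ p} := by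
        ext; simp
      rw [this]
      exact isOpen_biInter_finset fun p _ =>
        (isOpen_discrete {χ p}).preimage (SemiChar.continuous_eval p)
    obtain ⟨ψ, h1, h2⟩ := mem_closure_iff.1 h _ ho fun p _ => rfl
    obtain ⟨s, rfl⟩ := (mem_orbit_iff S).1 h2
    exact ⟨s, h1⟩
  · intro h
    refine mem_closure_iff.2 ?_
    rintro _ ⟨o, ho, rfl⟩ hχ
    obtain ⟨F, u, hu, hF⟩ := isOpen_pi_iff.1 ho _ hχ
    obtain ⟨s, hs⟩ := h F
    refine ⟨SemiChar.point s, hF fun p hp => ?_, (mem_orbit_iff S).2 ⟨s, rfl⟩⟩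
    have : SemiChar.point s p = χ p := hs p hp
    change SemiChar.point s p ∈ u p
    rw [this]
    exact (hu p hp).2

/-- Finitely many conditions `χ p = true` merge into one, because strong C*-regularity allows a
single ideal `X` to be intersected with complements. -/
theorem exists_inf (F : Finset (Idem S)) :
    ∃ P : Idem S, ∀ χ : SemiChar S, χ P = true ↔ ∀ p ∈ F, χ p = true := by
  classical
  induction F using Finset.induction_on with
  | empty => exact ⟨1, fun χ => by simp [χ.map_one]⟩
  | insert q F _ ih =>
    obtain ⟨P, hP⟩ := ih
    refine ⟨q * P, fun χ => ?_⟩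
    rw [χ.map_mul, Bool.and_eq_true, hP, Finset.forall_mem_insert]

theorem ofSet_eq (p : Idem S) (A : Set S) [DecidablePred (· ∈ A)]
    (hA : A = {t | (p.1.1 t).isSome = true}) : PEquiv.ofSet A = p.1.1 := by
  refine PEquiv.ext fun t => ?_
  by_cases h : (p.1.1 t).isSome = true
  · rw [Idem.apply_of_isSome p h]
    simp [PEquiv.ofSet, hA, h]
  · have h' : p.1.1 t = none := by simpa using h
    simp [PEquiv.ofSet, hA, h']

/-- The domain of an idempotent as a constructible ideal. -/
def Idem.ideal (p : Idem S) : constructibleIdeals S :=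
  ⟨{t | (p.1.1 t).isSome = true}, by
    have h := @ofSet_eq S _ _ p _ (fun _ => Classical.propDecidable _) rfl
    exact (congrArg InLeftInverseHull h).mpr p.1.2⟩

open scoped Classical in
/-- The idempotent of a constructible ideal. -/
def idemOfIdeal (X : constructibleIdeals S) : Idem S := ⟨idemOf X, by
  refine LeftInverseHull.ext (PEquiv.ext fun t => ?_)
  change ((PEquiv.ofSet X.1) t).bind (PEquiv.ofSet X.1) = _
  by_cases h : t ∈ X.1 <;> simp [idemOf, PEquiv.ofSet, h]⟩

theorem isSome_idemOfIdeal (X : constructibleIdeals S) (t : S) :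
    ((idemOfIdeal X).1.1 t).isSome = true ↔ t ∈ X.1 := by
  classical
  change ((PEquiv.ofSet X.1) t).isSome = true ↔ _
  by_cases h : t ∈ X.1 <;> simp [PEquiv.ofSet, h]

/-- Under strong C*-regularity, every `χ ∈ Ω(S)` is approximated by characters `χ_s` that are not
fixed by finitely many given elements whose germs at `χ` are not units. -/
theorem StronglyCStarRegular.exists_approx (hS : StronglyCStarRegular S) {χ : SemiChar S}
    (hχ : χ ∈ Omega S) (F : Finset (Idem S)) (G : Finset (LeftInverseHull S)) :
    ∃ s : S, (∀ p ∈ F, (p.1.1 s).isSome = χ p) ∧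
      ∀ g ∈ G, g.1 s = some s → SemiChar.GermEq χ g 1 := by
  classical
  by_contra! hc
  -- The values of `χ` on `F` are encoded as a set `X \ ⋃ X_i`: `P` gives `X`, the members of `N`
  -- give the `X_i`. The elements of `B` are the `h_k` of the regularity condition.
  obtain ⟨P, hP⟩ := exists_inf (F.filter fun p => χ p = true)
  have hχP : χ P = true := (hP χ).2 fun p hp => (Finset.mem_filter.1 hp).2
  set N := F.filter fun p => χ p = false
  set B := G.filter fun g => ¬ SemiChar.GermEq χ g 1
  have hmem : ∀ s, s ∈ P.ideal.1 \ ⋃ i, (N.equivFin.symm i).1.ideal.1 ↔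
      ∀ p ∈ F, (p.1.1 s).isSome = χ p := by
    intro s
    have h1 : s ∈ P.ideal.1 ↔ ∀ p ∈ F, χ p = true → (p.1.1 s).isSome = true := by
      refine (hP (SemiChar.point s)).trans ?_
      simp only [Finset.mem_filter, and_imp]
      exact Iff.rfl
    have h2 : s ∈ ⋃ i, (N.equivFin.symm i).1.ideal.1 ↔
        ∃ p ∈ F, χ p = false ∧ (p.1.1 s).isSome = true := by
      rw [Set.mem_iUnion]
      constructor
      · rintro ⟨i, hi⟩
        have := Finset.mem_filter.1 (N.equivFin.symm i).2
        exact ⟨_, this.1, this.2, hi⟩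
      · rintro ⟨p, hp, hp', hps⟩
        refine ⟨N.equivFin ⟨p, Finset.mem_filter.2 ⟨hp, hp'⟩⟩, ?_⟩
        rw [Equiv.symm_apply_apply]
        exact hps
    rw [Set.mem_sdiff, h1, h2]
    constructor
    · rintro ⟨h3, h4⟩ p hp
      cases hp' : χ p with
      | true => exact h3 p hp hp'
      | false =>
        by_contra h5
        exact h4 ⟨p, hp, hp', Bool.eq_true_of_not_eq_false h5⟩
    · intro h
      refine ⟨fun p hp hp' => (h p hp).trans hp', ?_⟩
      rintro ⟨p, hp, hp', h5⟩
      rw [h p hp, hp'] at h5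
      cases h5
  obtain ⟨l, Y, k, hY, hk⟩ := hS _ _ (fun i => (B.equivFin.symm i).1) P.ideal
    (fun i => (N.equivFin.symm i).1.ideal) (by
      obtain ⟨s, hs⟩ := mem_Omega_iff.1 hχ F
      exact ⟨s, (hmem s).2 hs⟩) (by
      intro s hs
      obtain ⟨g, hg, h1, h2⟩ := hc s ((hmem s).1 hs)
      refine Set.mem_iUnion.2 ⟨B.equivFin ⟨g, Finset.mem_filter.2 ⟨hg, h2⟩⟩, ?_⟩
      rw [Equiv.symm_apply_apply]
      exact h1)
  -- Approximate once more, now also on the idempotents of the `Y j`: the point `s` lies in some `Y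
  -- j`, hence `χ` takes the value 1 there, and a member of `B` has the germ of a unit.
  obtain ⟨s, hs⟩ := mem_Omega_iff.1 hχ (F ∪ Finset.univ.image fun j => idemOfIdeal (Y j))
  have hs1 := hY ((hmem s).2 fun p hp => hs p (Finset.mem_union_left _ hp))
  obtain ⟨j, hj⟩ := Set.mem_iUnion.1 hs1
  have hχY : χ (idemOfIdeal (Y j)) = true := by
    rw [← hs _ (Finset.mem_union_right _ (Finset.mem_image_of_mem _ (Finset.mem_univ j)))]
    exact (isSome_idemOfIdeal _ _).2 hj
  have hgB := Finset.mem_filter.1 (B.equivFin.symm (k j)).2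
  refine hgB.2 ⟨idemOfIdeal (Y j), Idem.mul_idem_eq_iff.1 ?_, hχY⟩
  rw [one_mul]
  exact hk j

/-- Under strong C*-regularity, finitely many germs at `χ ∈ Ω(S)` can be told apart at a point. -/
theorem StronglyCStarRegular.exists_separating (hS : StronglyCStarRegular S) {χ : SemiChar S}
    (hχ : χ ∈ Omega S) (P : Finset (LeftInverseHull S × LeftInverseHull S))
    (hP : ∀ x ∈ P, χ (Idem.dom x.2) = true) :
    ∃ s : S, ∀ x ∈ P, (x.2.1 s).isSome = true ∧ (x.1.1 s = x.2.1 s ↔ χ.GermEq x.1 x.2) := by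
  classical
  -- `q x` witnesses equality of the germs of the pair; the value 1 for pairs with different germs
  -- imposes no condition.
  let q : LeftInverseHull S × LeftInverseHull S → Idem S := fun x =>
    if h : χ.GermEq x.1 x.2 then h.choose else 1
  -- If `x.2` is defined at `s` and `x.1 s = x.2 s`, then `x.2⁻¹ * x.1` fixes `s`. So excluding
  -- accidental coincidences amounts to excluding accidental fixed points.
  obtain ⟨s, h1, h2⟩ := hS.exists_approx hχ (P.image q ∪ P.image fun x => Idem.dom x.2)
    (P.image fun x => x.2⁻¹ * x.1)
  refine ⟨s, fun x hx => ?_⟩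
  have hd : (x.2.1 s).isSome = true := by
    rw [← Idem.isSome_dom, h1 _ (Finset.mem_union_right _ (Finset.mem_image_of_mem _ hx))]
    exact hP x hx
  obtain ⟨u, hu⟩ := Option.isSome_iff_exists.1 hd
  have hu' : x.2⁻¹.1 u = some s := (PEquiv.eq_some_iff _).2 hu
  refine ⟨hd, fun h => ?_, fun h => ?_⟩
  · obtain ⟨p, hp, hχp⟩ := h2 _ (Finset.mem_image_of_mem _ hx) (by
      rw [mul_apply, h, hu, Option.bind_some, hu'])
    refine ⟨p, fun t ht => ?_, hχp⟩
    have h3 : (x.2⁻¹ * x.1).1 t = some t := hp t ht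
    rw [mul_apply, Option.bind_eq_some_iff] at h3
    obtain ⟨v, hv, hv'⟩ := h3
    rw [hv]
    exact ((PEquiv.eq_some_iff _).1 hv').symm
  · have hq : q x = h.choose := dif_pos h
    refine h.choose_spec.1 s ?_
    rw [← hq, h1 _ (Finset.mem_union_left _ (Finset.mem_image_of_mem _ hx)), hq]
    exact h.choose_spec.2

end LeftInverseHullLemmas

/-! ### Matrices of operators on `ℓ²` -/

namespace EllTwo

variable {α β : Type*}

open scoped Classical in
theorem coe_sum_single (t : Finset α) (ι : α → β) (c : α → ℂ) (j : β) :
    (∑ i ∈ t, c i • (lp.single 2 (ι i) (1 : ℂ) : EllTwo β) : EllTwo β) j =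
      ∑ i ∈ t, if j = ι i then c i else 0 := by
  rw [lp.coeFn_sum, Finset.sum_apply]
  refine Finset.sum_congr rfl fun i _ => ?_
  by_cases h : j = ι i
  · subst h
    simp
  · simp [lp.single_apply, h]

-- Pythagoras for distinct basis vectors. The right side does not involve `ι`, so moving a finitely
-- supported vector along an injection preserves its norm.
open scoped Classical in
theorem norm_sum_single (t : Finset α) (ι : α → β) (hι : Set.InjOn ι t) (c : α → ℂ) :
    ‖(∑ i ∈ t, c i • (lp.single 2 (ι i) (1 : ℂ) : EllTwo β) : EllTwo β)‖ ^ (2 : ℝ) =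
      ∑ i ∈ t, ‖c i‖ ^ (2 : ℝ) := by
  have h2 : (0 : ℝ) < (2 : ℝ≥0∞).toReal := by norm_num
  have h22 : (2 : ℝ≥0∞).toReal = (2 : ℝ) := by norm_num
  have h := lp.norm_rpow_eq_tsum h2
    (∑ i ∈ t, c i • (lp.single 2 (ι i) (1 : ℂ) : EllTwo β) : EllTwo β)
  rw [h22] at h
  rw [h, tsum_eq_sum (s := t.image ι), Finset.sum_image hι]
  · refine Finset.sum_congr rfl fun i hi => ?_
    rw [coe_sum_single, Finset.sum_eq_single i]
    · simp
    · intro k hk hki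
      exact if_neg fun h => hki (hι hk hi h.symm)
    · exact fun h => absurd hi h
  · intro j hj
    rw [coe_sum_single, Finset.sum_eq_zero]
    · simp
    · intro i hi
      exact if_neg fun h => hj (by rw [h]; exact Finset.mem_image_of_mem ι hi)

open scoped Classical in
theorem single_apply_of_ne {i j : α} (h : j ≠ i) :
    (lp.single 2 i (1 : ℂ) : EllTwo α) j = 0 :=
  lp.single_apply_ne (E := fun _ => ℂ) 2 i (1 : ℂ) h

open scoped Classical in
/-- The matrix entries `(Tδ_i)(j)` of an operator. -/
def entry (T : EllTwo α →L[ℂ] EllTwo β) (i : α) (j : β) : ℂ := T (lp.single 2 i (1 : ℂ)) j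

theorem entry_add (T T' : EllTwo α →L[ℂ] EllTwo β) (i : α) (j : β) :
    entry (T + T') i j = entry T i j + entry T' i j := rfl

theorem entry_smul (c : ℂ) (T : EllTwo α →L[ℂ] EllTwo β) (i : α) (j : β) :
    entry (c • T) i j = c * entry T i j := rfl

open scoped Classical in
theorem apply_sum_single (T : EllTwo α →L[ℂ] EllTwo β) {κ : Type*} (t : Finset κ) (ι : κ → α)
    (c : κ → ℂ) (j : β) :
    T (∑ i ∈ t, c i • lp.single 2 (ι i) (1 : ℂ)) j = ∑ i ∈ t, c i * entry T (ι i) j := by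
  rw [map_sum, lp.coeFn_sum, Finset.sum_apply]
  refine Finset.sum_congr rfl fun i _ => ?_
  rw [map_smul]
  rfl

open scoped Classical in
theorem hasSum_single (ξ : EllTwo α) :
    HasSum (fun i => ξ i • (lp.single 2 i (1 : ℂ) : EllTwo α)) ξ := by
  have := lp.hasSum_single (p := 2) (by norm_num) ξ
  convert this using 2 with i
  rw [← lp.single_smul]
  simp

/-- If every finite block of the matrix of `T` is a block of the matrix of `T'`, then
`‖T‖ ≤ ‖T'‖`. -/
theorem norm_le_of_blocks (T : EllTwo α →L[ℂ] EllTwo α) (T' : EllTwo β →L[ℂ] EllTwo β)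
    (h : ∀ t : Finset α, ∃ ι : α → β, Set.InjOn ι t ∧ ∀ i ∈ t, ∀ j ∈ t,
      entry T i j = entry T' (ι i) (ι j)) :
    ‖T‖ ≤ ‖T'‖ := by
  classical
  have h2 : (0 : ℝ) < (2 : ℝ≥0∞).toReal := by norm_num
  have key : ∀ (t : Finset α) (c : α → ℂ),
      ‖T (∑ i ∈ t, c i • lp.single 2 i (1 : ℂ))‖ ≤
        ‖T'‖ * ‖(∑ i ∈ t, c i • lp.single 2 i (1 : ℂ) : EllTwo α)‖ := by
    intro t c
    refine lp.norm_le_of_forall_sum_le h2 (by positivity) fun t' => ?_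
    -- The columns of the block are indexed by `t`, the support of the vector, and the rows by `t'`,
    -- where the output is tested; one injection must serve both.
    obtain ⟨ι, hι, hT⟩ := h (t ∪ t')
    have hι' : Set.InjOn ι t' := hι.mono (by simp)
    obtain ⟨η, hn, hc⟩ : ∃ η : EllTwo β,
        ‖η‖ = ‖(∑ i ∈ t, c i • lp.single 2 i (1 : ℂ) : EllTwo α)‖ ∧
        ∀ j ∈ t', T (∑ i ∈ t, c i • lp.single 2 i (1 : ℂ)) j = T' η (ι j) := by
      refine ⟨∑ i ∈ t, c i • lp.single 2 (ι i) (1 : ℂ), ?_, fun j hj => ?_⟩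
      · refine (Real.rpow_left_inj (norm_nonneg _) (norm_nonneg _) (two_ne_zero)).1 ?_
        rw [norm_sum_single t ι (hι.mono (by simp)), norm_sum_single t (fun i => i) (by simp)]
      · rw [apply_sum_single, apply_sum_single]
        refine Finset.sum_congr rfl fun i hi => ?_
        rw [hT i (Finset.mem_union_left _ hi) j (Finset.mem_union_right _ hj)]
    generalize (∑ i ∈ t, c i • lp.single 2 i (1 : ℂ) : EllTwo α) = ξ at hn hc
    calc ∑ j ∈ t', ‖T ξ j‖ ^ (2 : ℝ≥0∞).toReal
        = ∑ j ∈ t', ‖T' η (ι j)‖ ^ (2 : ℝ≥0∞).toReal :=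
          Finset.sum_congr rfl fun j hj => by rw [hc j hj]
      _ = ∑ j ∈ t'.image ι, ‖T' η j‖ ^ (2 : ℝ≥0∞).toReal := by
          rw [Finset.sum_image hι']
      _ ≤ ‖T' η‖ ^ (2 : ℝ≥0∞).toReal := lp.sum_rpow_le_norm_rpow h2 _ _
      _ ≤ (‖T'‖ * ‖ξ‖) ^ (2 : ℝ≥0∞).toReal := by
          rw [← hn]
          exact Real.rpow_le_rpow (norm_nonneg _) (T'.le_opNorm _) h2.le
  refine T.opNorm_le_bound (norm_nonneg _) fun ξ => ?_
  have hξ := hasSum_single ξ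
  have h1 : Filter.Tendsto (fun t : Finset α => ‖T (∑ i ∈ t, ξ i • lp.single 2 i (1 : ℂ))‖)
      Filter.atTop (𝓝 ‖T ξ‖) := ((T.continuous.tendsto ξ).comp hξ).norm
  have h3 : Filter.Tendsto
      (fun t : Finset α => ‖T'‖ * ‖(∑ i ∈ t, ξ i • lp.single 2 i (1 : ℂ) : EllTwo α)‖)
      Filter.atTop (𝓝 (‖T'‖ * ‖ξ‖)) := (Filter.Tendsto.norm hξ).const_mul _
  exact le_of_tendsto_of_tendsto' h1 h3 fun t => key t _

/-- Operators are determined by their matrices. -/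
theorem ext_entry {T T' : EllTwo α →L[ℂ] EllTwo β} (h : ∀ i j, entry T i j = entry T' i j) :
    T = T' := by
  classical
  refine ContinuousLinearMap.ext fun ξ => ?_
  refine (T.hasSum (hasSum_single ξ)).unique ?_
  convert T'.hasSum (hasSum_single ξ) using 2 with i
  rw [map_smul, map_smul]
  congr 1
  exact lp.ext (funext fun j => h i j)

end EllTwo

/-! ### Matrices and norms of the regular representations -/

section RegularRepresentations

variable {X : Type*} [Groupoid X]

/-- Functions supported on a bisection act by operators bounded by their supremum norms. -/
theorem exists_conv_of_bisection (f : Arr X → ℂ) (U : Set (Arr X))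
    (hs : Set.InjOn Arr.src U) (hr : Set.InjOn Arr.tgt U) (hU : ∀ γ, γ ∉ U → f γ = 0)
    (C : ℝ) (hC0 : 0 ≤ C) (hC : ∀ γ, ‖f γ‖ ≤ C) (x : X) :
    ∃ T : EllTwo (SourceFiber x) →L[ℂ] EllTwo (SourceFiber x),
      ‖T‖ ≤ C ∧ ∀ ξ g, T ξ g = convApply f ξ g := by
  classical
  have hmem : ∀ γ, f γ ≠ 0 → γ ∈ U := fun γ h => by
    by_contra hc
    exact h (hU γ hc)
  have huniq : ∀ (y : X) (h h' : RangeFiber y), f h.toArr ≠ 0 → f h'.toArr ≠ 0 → h = h' := by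
    rintro y ⟨z, h⟩ ⟨z', h'⟩ hh hh'
    have := hr (hmem _ hh) (hmem _ hh') rfl
    simp only [RangeFiber.toArr, Arr.mk.injEq] at this
    obtain ⟨rfl, -, h3⟩ := this
    obtain rfl := eq_of_heq h3
    rfl
  -- The only arrow with range `y` at which `f` can be nonzero. If there is none, the unit serves as
  -- a default, where `f` vanishes, so the weight is 0.
  let pick : ∀ y : X, RangeFiber y := fun y =>
    if hy : ∃ h : RangeFiber y, f h.toArr ≠ 0 then hy.choose else ⟨y, 𝟙 y⟩
  have hpick : ∀ (y : X) (h : RangeFiber y), f h.toArr ≠ 0 → h = pick y := by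
    intro y h hh
    have hy : ∃ h : RangeFiber y, f h.toArr ≠ 0 := ⟨h, hh⟩
    have : pick y = hy.choose := dif_pos hy
    rw [this]
    exact huniq y _ _ hh hy.choose_spec
  obtain ⟨T, hT, e⟩ := EllTwo.exists_weighted (α := SourceFiber x) (β := SourceFiber x)
    (fun g => ⟨(pick g.1).1, g.2 ≫ Groupoid.inv (pick g.1).2⟩) (fun g => f (pick g.1).toArr)
    C hC0 (by
      rintro ⟨y, g⟩ hg ⟨y', g'⟩ hg' heq
      change f (pick y).toArr ≠ 0 at hg
      change f (pick y').toArr ≠ 0 at hg'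
      change (⟨(pick y).1, g ≫ Groupoid.inv (pick y).2⟩ : SourceFiber x) =
        ⟨(pick y').1, g' ≫ Groupoid.inv (pick y').2⟩ at heq
      generalize hp : pick y = p at *
      generalize hp' : pick y' = p' at *
      clear hp hp'
      obtain ⟨z, h⟩ := p
      obtain ⟨z', h'⟩ := p'
      have h1 : z = z' := congrArg Sigma.fst heq
      have := hs (hmem _ hg) (hmem _ hg') h1
      simp only [RangeFiber.toArr, Arr.mk.injEq] at this
      obtain ⟨rfl, rfl, h3⟩ := this
      obtain rfl := eq_of_heq h3
      simp only [Sigma.mk.injEq, heq_eq_eq, true_and] at heq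
      have := (cancel_mono (Groupoid.inv h)).1 heq
      rw [this])
    (fun g => hC _)
  refine ⟨T, hT, fun ξ g => ?_⟩
  rw [e, convApply, tsum_eq_single (pick g.1)]
  intro h hh
  by_cases h0 : f h.toArr = 0
  · rw [h0, zero_mul]
  · exact absurd (hpick _ _ h0) hh

variable [TopologicalSpace (Arr X)] [HasOpenBisections X]

/-- The matrix of `ρ_x(f)`. -/
theorem entry_rho (x : X) (f : Cc X) (k l : SourceFiber x) :
    EllTwo.entry (rho x f) k l = (f : Arr X → ℂ) ⟨k.1, l.1, Groupoid.inv k.2 ≫ l.2⟩ := by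
  classical
  -- Only the arrow `h` with `h⁻¹l = k` contributes, that is, `h = lk⁻¹`.
  rw [EllTwo.entry, rho_apply, tsum_eq_single (⟨k.1, Groupoid.inv k.2 ≫ l.2⟩ : RangeFiber l.1)]
  · have : (⟨k.1, l.2 ≫ Groupoid.inv (Groupoid.inv k.2 ≫ l.2)⟩ : SourceFiber x) = k := by
      simp
    simp only [this]
    simp
  · intro h hh
    have : (⟨h.1, l.2 ≫ Groupoid.inv h.2⟩ : SourceFiber x) ≠ k := by
      rintro rfl
      exact hh (by simp)
    exact mul_eq_zero_of_right _ (EllTwo.single_apply_of_ne this)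

theorem rho_add (x : X) (f g : Cc X) : rho x (f + g) = rho x f + rho x g :=
  EllTwo.ext_entry fun k l => by
    rw [EllTwo.entry_add, entry_rho, entry_rho, entry_rho]
    rfl

theorem rho_smul (x : X) (c : ℂ) (f : Cc X) : rho x (c • f) = c • rho x f :=
  EllTwo.ext_entry fun k l => by
    rw [EllTwo.entry_smul, entry_rho, entry_rho]
    rfl

theorem BoundedFamilies.ext_eval {Y : Type*} {H : Y → Type*} [∀ x, NormedAddCommGroup (H x)]
    [∀ x, InnerProductSpace ℂ (H x)] [∀ x, CompleteSpace (H x)] {a b : BoundedFamilies H}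
    (h : ∀ x, eval x a = eval x b) : a = b :=
  lp.ext (funext h)

theorem BoundedFamilies.norm_eval_le {Y : Type*} {H : Y → Type*} [∀ x, NormedAddCommGroup (H x)]
    [∀ x, InnerProductSpace ℂ (H x)] [∀ x, CompleteSpace (H x)] (a : BoundedFamilies H) (x : Y) :
    ‖eval x a‖ ≤ ‖a‖ :=
  lp.norm_apply_le_norm ENNReal.top_ne_zero (show lp (fun x => H x →L[ℂ] H x) ∞ from a) x

theorem BoundedFamilies.norm_le {Y : Type*} {H : Y → Type*} [∀ x, NormedAddCommGroup (H x)]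
    [∀ x, InnerProductSpace ℂ (H x)] [∀ x, CompleteSpace (H x)] {a : BoundedFamilies H} {C : ℝ}
    (hC : 0 ≤ C) (h : ∀ x, ‖eval x a‖ ≤ C) : ‖a‖ ≤ C :=
  lp.norm_le_of_forall_le hC h

variable (X) in
/-- The map `f ↦ (ρ_x(f))_x` as a linear map. -/
def regRepₗ : Cc X →ₗ[ℂ] ProdB X where
  toFun := regRep
  map_add' f g := BoundedFamilies.ext_eval fun x => rho_add x f g
  map_smul' c f := BoundedFamilies.ext_eval fun x => rho_smul x c f

/-- On a bisection each `ρ_x(f)` is a weighted partial permutation, so the supremum norm dominates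
the reduced norm. This permits uniform approximation of functions on `Ω(S)`. -/
theorem norm_regRep_le_of_bisection (f : Cc X) (U : Set (Arr X))
    (hs : Set.InjOn Arr.src U) (hr : Set.InjOn Arr.tgt U)
    (hU : ∀ γ, γ ∉ U → (f : Arr X → ℂ) γ = 0)
    (C : ℝ) (hC0 : 0 ≤ C) (hC : ∀ γ, ‖(f : Arr X → ℂ) γ‖ ≤ C) : ‖regRep f‖ ≤ C := by
  refine BoundedFamilies.norm_le hC0 fun x => ?_
  obtain ⟨T, hT, e⟩ := exists_conv_of_bisection (f : Arr X → ℂ) U hs hr hU C hC0 hC x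
  have : BoundedFamilies.eval x (regRep f) = T := ContinuousLinearMap.ext fun ξ =>
    lp.ext <| funext fun g => by
      rw [e]
      exact rho_apply x f ξ g
  rw [this]
  exact hT

end RegularRepresentations

/-! ### Topology of the Paterson groupoid, and Stone–Weierstrass on bisections -/

section PatersonTopology

variable {S : Type*} [Monoid S] [IsLeftCancelMul S]

open LeftInverseHull

namespace SemiChar

theorem toFun_injective : Function.Injective (toFun (S := S)) := fun _ _ h => SemiChar.ext h

/-- For multiplicative functions, being nonzero is equivalent to the closed condition `f 1 = true`;
hence the space of semi-characters is compact. -/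
theorem isClosed_range_toFun : IsClosed (Set.range (toFun (S := S))) := by
  have : Set.range (toFun (S := S)) =
      (⋂ p, ⋂ q, {f : Idem S → Bool | f (p * q) = (f p && f q)}) ∩ {f | f 1 = true} := by
    ext f
    simp only [Set.mem_range, Set.mem_inter_iff, Set.mem_iInter]
    constructor
    · rintro ⟨χ, rfl⟩
      exact ⟨χ.map_mul, χ.map_one⟩
    · rintro ⟨h1, h2⟩
      exact ⟨⟨f, h1, 1, h2⟩, rfl⟩
  rw [this]
  refine (isClosed_iInter fun p => isClosed_iInter fun q => ?_).inter ?_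
  · refine isClosed_eq (continuous_apply _) ?_
    have : Continuous fun x : Bool × Bool => (x.1 && x.2) := continuous_of_discreteTopology
    have hc : Continuous fun f : Idem S → Bool => (f p, f q) :=
      (continuous_apply p).prodMk (continuous_apply q)
    exact this.comp hc
  · exact isClosed_eq (continuous_apply _) continuous_const

theorem isClosedEmbedding_toFun : IsClosedEmbedding (toFun (S := S)) :=
  ⟨⟨⟨rfl⟩, toFun_injective⟩, isClosed_range_toFun⟩

instance : CompactSpace (SemiChar S) := isClosedEmbedding_toFun.compactSpace

instance : T2Space (SemiChar S) := isClosedEmbedding_toFun.isEmbedding.t2Space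

instance : TotallyDisconnectedSpace (SemiChar S) :=
  ⟨isClosedEmbedding_toFun.isEmbedding.isTotallyDisconnected
    (isTotallyDisconnected_of_totallyDisconnectedSpace _)⟩

theorem isOpen_setOf_eq_true (p : Idem S) : IsOpen {χ : SemiChar S | χ p = true} :=
  (isOpen_discrete {true}).preimage (continuous_eval p)

theorem isOpen_setOf_germEq (g h : LeftInverseHull S) : IsOpen {χ : SemiChar S | χ.GermEq g h} := by
  have : {χ : SemiChar S | χ.GermEq g h} = ⋃ p : Idem S, ⋃ _ : ∀ t, (p.1.1 t).isSome = true →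
      g.1 t = h.1 t, {χ : SemiChar S | χ p = true} := by
    ext χ
    simp [GermEq]
  rw [this]
  exact isOpen_iUnion fun p => isOpen_iUnion fun _ => isOpen_setOf_eq_true p

/-- If `g` and `h` agree on the domain of `q`, then `g⁻¹pg` and `h⁻¹ph` coincide after
multiplication by `q`. In particular a germ determines its range. -/
theorem GermEq.conj {χ : SemiChar S} {g h : LeftInverseHull S} (H : χ.GermEq g h) (p : Idem S) :
    χ (Idem.conj g p) = χ (Idem.conj h p) := by
  obtain ⟨q, h1, h2⟩ := H
  have : Idem.conj g p * q = Idem.conj h p * q := Idem.ext_isSome fun t => by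
    rw [Idem.isSome_mul, Idem.isSome_mul]
    cases hq : (q.1.1 t).isSome with
    | false => simp
    | true =>
      rw [Bool.and_true, Bool.and_true]
      have h3 := h1 t hq
      cases hg : g.1 t with
      | none =>
        have hn : ∀ k : LeftInverseHull S, k.1 t = none →
            ((Idem.conj k p).1.1 t).isSome = false := fun k hk => by
          by_contra hc
          obtain ⟨u, hu⟩ := Idem.isSome_of_isSome_conj (Bool.eq_true_of_not_eq_false hc)
          rw [hk] at hu
          cases hu
        rw [hn g hg, hn h (h3 ▸ hg)]
      | some u => rw [Idem.isSome_conj hg, Idem.isSome_conj (h3 ▸ hg)]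
  have h4 := congrArg χ.toFun this
  rwa [χ.map_mul, χ.map_mul, h2, Bool.and_true, Bool.and_true] at h4

/-- The semi-character `χ(g⁻¹ · g)`. -/
def translate (g : LeftInverseHull S) (χ : SemiChar S) (h : χ (Idem.dom g) = true) :
    SemiChar S where
  toFun p := χ (Idem.conj g p)
  map_mul p q := by rw [Idem.conj_mul, χ.map_mul]
  ne_zero := ⟨1, by rw [Idem.conj_one, h]⟩

/-- If `χ_s` approximates `χ` on the domain of `g` and on the idempotents `g⁻¹pg`, then `χ_{g(s)}`
approximates the translate on the `p`. -/
theorem translate_mem_Omega (g : LeftInverseHull S) {χ : SemiChar S}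
    (h : χ (Idem.dom g) = true) (hχ : χ ∈ Omega S) : translate g χ h ∈ Omega S := by
  classical
  refine mem_Omega_iff.2 fun F => ?_
  obtain ⟨s, hs⟩ := mem_Omega_iff.1 hχ (insert (Idem.dom g) (F.image (Idem.conj g)))
  have hd := hs _ (Finset.mem_insert_self _ _)
  rw [h, Idem.isSome_dom] at hd
  obtain ⟨u, hu⟩ := Option.isSome_iff_exists.1 hd
  refine ⟨u, fun p hp => ?_⟩
  rw [← Idem.isSome_conj hu]
  exact hs _ (Finset.mem_insert_of_mem (Finset.mem_image_of_mem _ hp))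

/-- The proof that `g` carries `χ` to `ψ`, required by `basicSet`, is automatic once the germs
agree. -/
theorem mem_basicSet_iff {χ ψ : SemiChar S} (k : PreHom χ ψ) (g : LeftInverseHull S)
    (U : Set (SemiChar S)) :
    (⟨χ, ψ, Quotient.mk (germSetoid χ ψ) k⟩ : Arr (SemiChar S)) ∈ basicSet g U ↔
      χ ∈ U ∧ χ.GermEq g k.1 := by
  refine and_congr_right fun _ => ?_
  constructor
  · rintro ⟨hg, h⟩
    exact (mk_eq_mk_iff.1 h).symm
  · intro H
    exact ⟨⟨H.dom k.2.1, fun p => by rw [k.2.2, H.conj]⟩, mk_eq_mk_iff.2 H.symm⟩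

theorem continuous_src : Continuous (Arr.src : Arr (SemiChar S) → SemiChar S) := by
  refine continuous_def.2 fun U hU => ?_
  have : (Arr.src : Arr (SemiChar S) → SemiChar S) ⁻¹' U =
      ⋃ g : LeftInverseHull S, basicSet g (U ∩ {χ | χ (Idem.dom g) = true}) := by
    ext ⟨χ, ψ, ⟨k⟩⟩
    simp only [Set.mem_preimage, Set.mem_iUnion]
    constructor
    · intro h
      exact ⟨k.1, (mem_basicSet_iff k _ _).2 ⟨⟨h, k.2.1⟩, GermEq.refl⟩⟩
    · rintro ⟨g, h⟩
      exact h.1.1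
  rw [this]
  exact isOpen_iUnion fun g => TopologicalSpace.isOpen_generateFrom_of_mem
    ⟨g, _, hU.inter (isOpen_setOf_eq_true _), Set.inter_subset_right, rfl⟩

end SemiChar

open SemiChar

instance : CompactSpace (Omega S) :=
  isCompact_iff_compactSpace.1 (isClosed_closure (s := {χ | Nonempty (point (1 : S) ⟶ χ)})).isCompact

namespace GroupoidP

/-- The source of an arrow as a point of `Ω(S)`. -/
def source (γ : Arr (GroupoidP S)) : Omega S := ⟨γ.src.1, γ.src.2⟩

theorem continuous_source : Continuous (source (S := S)) := by
  have : Continuous (Reduction.incl (Omega S)) := continuous_induced_dom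
  exact (continuous_src.comp this).subtype_mk fun γ => γ.src.2

/-- The characters `χ ∈ Ω(S)` with `χ(g⁻¹g) = 1`. -/
def domSet (g : LeftInverseHull S) : Set (Omega S) := {χ | χ.1 (Idem.dom g) = true}

theorem isClosed_domSet (g : LeftInverseHull S) : IsClosed (domSet g) :=
  (isClosed_discrete {true}).preimage ((continuous_eval (Idem.dom g)).comp continuous_subtype_val)

instance (g : LeftInverseHull S) : CompactSpace (domSet g) :=
  isCompact_iff_compactSpace.1 (isClosed_domSet g).isCompact

/-- The arrow `[g, χ]`. -/
def germArr (g : LeftInverseHull S) (χ : domSet g) : Arr (GroupoidP S) where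
  src := ⟨χ.1.1, χ.1.2⟩
  tgt := ⟨translate g χ.1.1 χ.2, translate_mem_Omega g χ.2 χ.1.2⟩
  hom := Quotient.mk (germSetoid χ.1.1 (translate g χ.1.1 χ.2)) ⟨g, χ.2, fun _ => rfl⟩

theorem germArr_injective (g : LeftInverseHull S) : Function.Injective (germArr g) :=
  fun _ _ h => Subtype.ext (congrArg source h)

/-- The set of arrows `[g, χ]`. -/
def bisection (g : LeftInverseHull S) : Set (Arr (GroupoidP S)) :=
  Reduction.incl (Omega S) ⁻¹' basicSet g {χ | χ (Idem.dom g) = true}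

theorem isOpen_bisection (g : LeftInverseHull S) : IsOpen (bisection g) :=
  ⟨_, TopologicalSpace.isOpen_generateFrom_of_mem
    ⟨g, _, isOpen_setOf_eq_true _, subset_rfl, rfl⟩, rfl⟩

theorem mk_mem_bisection_iff {x y : GroupoidP S} (k : PreHom x.1 y.1) (g : LeftInverseHull S) :
    (⟨x, y, Quotient.mk (germSetoid x.1 y.1) k⟩ : Arr (GroupoidP S)) ∈ bisection g ↔
      x.1.GermEq g k.1 :=
  (mem_basicSet_iff k g _).trans ⟨fun h => h.2, fun h => ⟨h.dom k.2.1, h⟩⟩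

theorem range_germArr (g : LeftInverseHull S) : Set.range (germArr g) = bisection g := by
  ext γ
  constructor
  · rintro ⟨χ, rfl⟩
    exact (mk_mem_bisection_iff (x := ⟨χ.1.1, χ.1.2⟩)
      (y := ⟨translate g χ.1.1 χ.2, translate_mem_Omega g χ.2 χ.1.2⟩) _ g).2 GermEq.refl
  · obtain ⟨⟨χ, hχ⟩, ⟨ψ, hψ⟩, f⟩ := γ
    rintro ⟨h1, hg, h2⟩
    have hd : χ (Idem.dom g) = true := h1
    obtain rfl : translate g χ hd = ψ := SemiChar.ext (funext fun p => (hg.2 p).symm)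
    refine ⟨⟨⟨χ, hχ⟩, hd⟩, ?_⟩
    change f = _ at h2
    rw [h2]
    rfl

theorem source_mem_domSet {g : LeftInverseHull S} {γ : Arr (GroupoidP S)} (h : γ ∈ bisection g) :
    source γ ∈ domSet g := h.1

theorem germArr_source {g : LeftInverseHull S} {γ : Arr (GroupoidP S)} (h : γ ∈ bisection g) :
    germArr g ⟨source γ, source_mem_domSet h⟩ = γ := by
  rw [← range_germArr] at h
  obtain ⟨χ, rfl⟩ := h
  rfl

/-- Pulling `D(h, U)` back along `χ ↦ [g, χ]` gives the points of `U` where the germs of `g` and `h`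
agree, an open condition. This makes `bisection g` compact, as the image of a closed subset of
`Ω(S)`. -/
theorem continuous_germArr (g : LeftInverseHull S) : Continuous (germArr g) := by
  refine continuous_induced_rng.2 (continuous_generateFrom_iff.2 ?_)
  rintro _ ⟨h, U, hU, -, rfl⟩
  have : Reduction.incl (Omega S) ∘ germArr g ⁻¹' basicSet h U =
      (fun χ : domSet g => χ.1.1) ⁻¹' (U ∩ {χ | χ.GermEq h g}) := by
    ext χ
    exact mem_basicSet_iff _ h U
  rw [this]
  exact (hU.inter (isOpen_setOf_germEq h g)).preimage
    (continuous_subtype_val.comp continuous_subtype_val)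

theorem isCompact_bisection (g : LeftInverseHull S) : IsCompact (bisection g) := by
  rw [← range_germArr]
  exact isCompact_range (continuous_germArr g)

theorem injOn_source (g : LeftInverseHull S) : Set.InjOn source (bisection g) := by
  intro γ hγ δ hδ h
  rw [← germArr_source hγ, ← germArr_source hδ]
  congr 1
  exact Subtype.ext h

theorem injOn_src (g : LeftInverseHull S) : Set.InjOn Arr.src (bisection g) := by
  intro γ hγ δ hδ h
  exact injOn_source g hγ hδ (Subtype.ext (congrArg Reduction.val h))

theorem injOn_tgt (g : LeftInverseHull S) : Set.InjOn Arr.tgt (bisection g) := by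
  rintro ⟨⟨χ₁, _⟩, ⟨ψ₁, _⟩, _⟩ hγ ⟨⟨χ₂, _⟩, ⟨ψ₂, _⟩, _⟩ hδ h
  refine injOn_source g hγ hδ (Subtype.ext (SemiChar.ext (funext fun p => ?_)))
  obtain ⟨h1, hg, h2⟩ := hγ
  obtain ⟨h1', hg', h2'⟩ := hδ
  have h3 : ψ₁ = ψ₂ := congrArg Reduction.val h
  have e1 := PreHom.src_eq ⟨g, hg⟩ p
  have e2 := PreHom.src_eq ⟨g, hg'⟩ p
  change χ₁ p = ψ₁ _ at e1
  change χ₂ p = ψ₂ _ at e2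
  exact (e1.trans (congrArg (fun ψ : SemiChar S => ψ (Idem.conj g⁻¹ p)) h3)).trans e2.symm

/-- The source map injects the bisection continuously into the Hausdorff space `Ω(S)`; the whole
groupoid need not be Hausdorff. -/
instance (g : LeftInverseHull S) : T2Space (bisection g) :=
  T2Space.of_injective_continuous (f := fun γ : bisection g => source γ.1)
    (fun γ δ h => Subtype.ext (injOn_source g γ.2 δ.2 h))
    (continuous_source.comp continuous_subtype_val)

open scoped Classical in
/-- The function on the groupoid that is `φ ∘ source` on `bisection g`, and zero elsewhere. -/
def lift (g : LeftInverseHull S) : C(Omega S, ℂ) →ₗ[ℂ] Cc (GroupoidP S) where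
  toFun φ := ⟨fun γ => if γ ∈ bisection g then φ (source γ) else 0, by
    refine Submodule.subset_span ⟨bisection g, isOpen_bisection g, inferInstance, ?_,
      bisection g, subset_rfl, isCompact_bisection g, fun γ hγ => if_neg hγ⟩
    exact (φ.continuous.comp continuous_source).continuousOn.congr fun γ hγ => if_pos hγ⟩
  map_add' φ ψ := by
    refine Subtype.ext (funext fun γ => ?_)
    change (if γ ∈ bisection g then φ (source γ) + ψ (source γ) else 0) =
      (if γ ∈ bisection g then φ (source γ) else 0) + (if γ ∈ bisection g then ψ (source γ) else 0)
    split_ifs <;> simp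
  map_smul' c φ := by
    refine Subtype.ext (funext fun γ => ?_)
    change (if γ ∈ bisection g then c * φ (source γ) else 0) =
      c * (if γ ∈ bisection g then φ (source γ) else 0)
    split_ifs <;> simp

theorem lift_of_mem {g : LeftInverseHull S} {γ : Arr (GroupoidP S)} (h : γ ∈ bisection g)
    (φ : C(Omega S, ℂ)) : (lift g φ : Arr (GroupoidP S) → ℂ) γ = φ (source γ) := if_pos h

theorem lift_of_notMem {g : LeftInverseHull S} {γ : Arr (GroupoidP S)} (h : γ ∉ bisection g)
    (φ : C(Omega S, ℂ)) : (lift g φ : Arr (GroupoidP S) → ℂ) γ = 0 := if_neg h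

/-- The characteristic function of `bisection g`. -/
def ind (g : LeftInverseHull S) : Cc (GroupoidP S) := lift g 1

theorem norm_regRep_lift_le (g : LeftInverseHull S) (φ : C(Omega S, ℂ)) :
    ‖regRep (lift g φ)‖ ≤ ‖φ‖ := by
  refine norm_regRep_le_of_bisection _ (bisection g) (injOn_src g) (injOn_tgt g)
    (fun γ hγ => lift_of_notMem hγ φ) _ (norm_nonneg _) fun γ => ?_
  by_cases h : γ ∈ bisection g
  · rw [lift_of_mem h]
    exact φ.norm_coe_le_norm _
  · rw [lift_of_notMem h, norm_zero]
    exact norm_nonneg _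

open scoped Classical in
/-- The function `χ ↦ χ(p)`. -/
def evalAt (p : Idem S) : C(Omega S, ℂ) where
  toFun χ := if χ.1 p = true then 1 else 0
  continuous_toFun := by
    have : Continuous fun b : Bool => (if b = true then 1 else 0 : ℂ) :=
      continuous_of_discreteTopology
    exact this.comp ((continuous_eval p).comp continuous_subtype_val)

/-- Where `χ(p) = 1` the germs of `gp` and `g` agree, and elsewhere `gp` has no germ. Thus linear
combinations of the functions `evalAt p` lift to combinations of characteristic functions of
bisections. -/
theorem lift_evalAt (g : LeftInverseHull S) (p : Idem S) : lift g (evalAt p) = ind (g * p.1) := by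
  refine Subtype.ext (funext fun γ => ?_)
  obtain ⟨x, y, ⟨k⟩⟩ := γ
  have hmem : (⟨x, y, Quotient.mk (germSetoid x.1 y.1) k⟩ : Arr (GroupoidP S)) ∈
      bisection (g * p.1) ↔
      (⟨x, y, Quotient.mk (germSetoid x.1 y.1) k⟩ : Arr (GroupoidP S)) ∈ bisection g ∧
        x.1 p = true := by
    rw [mk_mem_bisection_iff, mk_mem_bisection_iff]
    have hp : x.1 p = true → x.1.GermEq (g * p.1) g := fun h =>
      ⟨p, fun t ht => by rw [mul_apply, Idem.apply_of_isSome p ht, Option.bind_some], h⟩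
    constructor
    · intro h
      have h1 : x.1 p = true := by
        refine x.1.map_le (fun t ht => ?_) (GermEq.of_dom_mul (h.dom k.2.1))
        rwa [Idem.isSome_dom] at ht
      exact ⟨(hp h1).symm.trans h, h1⟩
    · rintro ⟨h1, h2⟩
      exact (hp h2).trans h1
  change (lift g (evalAt p) : Arr (GroupoidP S) → ℂ) ⟨x, y, Quotient.mk (germSetoid x.1 y.1) k⟩ =
    (ind (g * p.1) : Arr (GroupoidP S) → ℂ) ⟨x, y, Quotient.mk (germSetoid x.1 y.1) k⟩
  by_cases h : (⟨x, y, Quotient.mk (germSetoid x.1 y.1) k⟩ : Arr (GroupoidP S)) ∈ bisection g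
  · rw [lift_of_mem h]
    by_cases h' : x.1 p = true
    · rw [ind, lift_of_mem (hmem.2 ⟨h, h'⟩)]
      exact if_pos h'
    · rw [ind, lift_of_notMem fun hc => h' (hmem.1 hc).2]
      exact if_neg h'
  · rw [lift_of_notMem h, ind, lift_of_notMem fun hc => h (hmem.1 hc).1]

theorem evalAt_mul (p q : Idem S) : evalAt p * evalAt q = evalAt (p * q) := by
  ext χ
  change (if χ.1 p = true then 1 else 0) * (if χ.1 q = true then 1 else 0) =
    (if χ.1 (p * q) = true then 1 else 0 : ℂ)
  rw [χ.1.map_mul]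
  cases χ.1 p <;> cases χ.1 q <;> simp

theorem evalAt_one : evalAt (1 : Idem S) = 1 := by
  ext χ
  exact if_pos χ.1.map_one

theorem star_evalAt (p : Idem S) : star (evalAt p) = evalAt p := by
  ext χ
  change star (if χ.1 p = true then 1 else 0 : ℂ) = if χ.1 p = true then 1 else 0
  split_ifs <;> simp

variable (S) in
/-- The `*`-algebra spanned by the functions `χ ↦ χ(p)`. -/
def evalSubalgebra : StarSubalgebra ℂ C(Omega S, ℂ) where
  toSubalgebra := (Submodule.span ℂ (Set.range (evalAt (S := S)))).toSubalgebra
    (Submodule.subset_span ⟨1, evalAt_one⟩) (by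
      intro a b ha hb
      have h := Submodule.mul_mem_mul ha hb
      rw [Submodule.span_mul_span] at h
      refine Submodule.span_mono ?_ h
      rintro _ ⟨_, ⟨p, rfl⟩, _, ⟨q, rfl⟩, rfl⟩
      exact ⟨p * q, (evalAt_mul p q).symm⟩)
  star_mem' := by
    intro a ha
    change a ∈ Submodule.span ℂ (Set.range (evalAt (S := S))) at ha
    change star a ∈ Submodule.span ℂ (Set.range (evalAt (S := S)))
    induction ha using Submodule.span_induction with
    | mem _ h =>
      obtain ⟨p, rfl⟩ := h
      rw [star_evalAt]
      exact Submodule.subset_span ⟨p, rfl⟩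
    | zero => rw [star_zero]; exact zero_mem _
    | add a b _ _ ha hb => rw [star_add]; exact add_mem ha hb
    | smul c a _ ha => rw [star_smul]; exact Submodule.smul_mem _ _ ha

/-- Stone–Weierstrass: distinct semi-characters differ at some idempotent `p`, so `evalAt p`
separates them. -/
theorem evalSubalgebra_dense : (evalSubalgebra S).topologicalClosure = ⊤ := by
  refine ContinuousMap.starSubalgebra_topologicalClosure_eq_top_of_separatesPoints _ ?_
  intro χ ψ h
  obtain ⟨p, hp⟩ : ∃ p, χ.1 p ≠ ψ.1 p := by
    by_contra! hc
    exact h (Subtype.ext (SemiChar.ext (funext hc)))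
  refine ⟨evalAt p, ⟨evalAt p, Submodule.subset_span ⟨p, rfl⟩, rfl⟩, ?_⟩
  change (if χ.1 p = true then 1 else 0 : ℂ) ≠ if ψ.1 p = true then 1 else 0
  cases h1 : χ.1 p <;> cases h2 : ψ.1 p <;> simp_all

variable (S) in
/-- The span of the images of the characteristic functions of the sets `bisection g`. -/
def indSpan : Submodule ℂ (ProdB (GroupoidP S)) :=
  Submodule.span ℂ (Set.range fun g : LeftInverseHull S => regRep (ind g))

/-- The map `φ ↦ regRep (lift g φ)` is contractive and sends a dense subalgebra into the span. -/
theorem regRep_lift_mem (g : LeftInverseHull S) (φ : C(Omega S, ℂ)) :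
    regRep (lift g φ) ∈ (indSpan S).topologicalClosure := by
  let L : C(Omega S, ℂ) →L[ℂ] ProdB (GroupoidP S) :=
    ((regRepₗ (GroupoidP S)).comp (lift g)).mkContinuous 1 fun φ => by
      rw [one_mul]
      exact norm_regRep_lift_le g φ
  have hcl : IsClosed {φ | L φ ∈ (indSpan S).topologicalClosure} :=
    (indSpan S).isClosed_topologicalClosure.preimage L.continuous
  have hsub : (evalSubalgebra S : Set C(Omega S, ℂ)) ⊆
      {φ | L φ ∈ (indSpan S).topologicalClosure} := by
    have : Submodule.span ℂ (Set.range (evalAt (S := S))) ≤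
        (indSpan S).topologicalClosure.comap L.toLinearMap := by
      refine Submodule.span_le.2 ?_
      rintro _ ⟨p, rfl⟩
      refine Submodule.le_topologicalClosure _ (Submodule.subset_span ⟨g * p.1, ?_⟩)
      change _ = regRep (lift g (evalAt p))
      rw [lift_evalAt]
    exact this
  have hφ : φ ∈ closure (evalSubalgebra S : Set C(Omega S, ℂ)) := by
    rw [← StarSubalgebra.topologicalClosure_coe, evalSubalgebra_dense]
    trivial
  exact hcl.closure_subset_iff.2 hsub hφ

end GroupoidP
end PatersonTopology

/-! ### Cutting functions in `C_c` along compact open bisections -/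

section PatersonFunctions

variable {S : Type*} [Monoid S] [IsLeftCancelMul S]

open LeftInverseHull SemiChar

namespace GroupoidP

variable (S) in
/-- The span of the functions `lift g φ`. -/
def liftSpan : Submodule ℂ (Arr (GroupoidP S) → ℂ) :=
  Submodule.span ℂ {f | ∃ (g : LeftInverseHull S) (φ : C(Omega S, ℂ)), f = lift g φ}

/-- A function supported on `bisection g` and continuous there is of the form `lift g φ`. -/
theorem mem_liftSpan {g : LeftInverseHull S} {f : Arr (GroupoidP S) → ℂ}
    (hf : ∀ γ, γ ∉ bisection g → f γ = 0) (hc : Continuous (f ∘ germArr g)) : f ∈ liftSpan S := by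
  -- Tietze: the function lives on the closed set `domSet g`, while `lift` takes functions on all of
  -- `Ω(S)`.
  obtain ⟨φ, hφ⟩ := ContinuousMap.exists_restrict_eq (isClosed_domSet g) ⟨f ∘ germArr g, hc⟩
  refine Submodule.subset_span ⟨g, φ, funext fun γ => ?_⟩
  by_cases h : γ ∈ bisection g
  · rw [lift_of_mem h]
    have := congrArg (fun F : C(domSet g, ℂ) => F ⟨source γ, source_mem_domSet h⟩) hφ
    refine (Eq.trans this ?_).symm
    exact congrArg f (germArr_source h)
  · rw [lift_of_notMem h, hf γ h]

/-- The sets `{[g, χ] : χ ∈ C}` with `C` clopen. -/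
def IsCompactOpenBisection (W : Set (Arr (GroupoidP S))) : Prop :=
  ∃ (g : LeftInverseHull S) (C : Set (domSet g)), IsClopen C ∧ W = germArr g '' C

theorem IsCompactOpenBisection.isCompact {W : Set (Arr (GroupoidP S))}
    (h : IsCompactOpenBisection W) : IsCompact W := by
  obtain ⟨g, C, hC, rfl⟩ := h
  exact hC.1.isCompact.image (continuous_germArr g)

theorem IsCompactOpenBisection.isOpen {W : Set (Arr (GroupoidP S))}
    (h : IsCompactOpenBisection W) : IsOpen W := by
  obtain ⟨g, C, hC, rfl⟩ := h
  obtain ⟨O, hO, rfl⟩ := hC.2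
  have : germArr g '' (Subtype.val ⁻¹' O) = bisection g ∩ source ⁻¹' O := by
    ext γ
    constructor
    · rintro ⟨χ, hχ, rfl⟩
      refine ⟨?_, hχ⟩
      rw [← range_germArr]
      exact ⟨χ, rfl⟩
    · rintro ⟨h1, h2⟩
      exact ⟨⟨source γ, source_mem_domSet h1⟩, h2, germArr_source h1⟩
  rw [this]
  exact (isOpen_bisection g).inter (hO.preimage continuous_source)

/-- `domSet g` is compact, Hausdorff and totally disconnected, so its points have arbitrarily small
clopen neighbourhoods. -/
theorem exists_isCompactOpenBisection {V : Set (Arr (GroupoidP S))} (hV : IsOpen V)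
    {γ : Arr (GroupoidP S)} (hγ : γ ∈ V) :
    ∃ W, IsCompactOpenBisection W ∧ γ ∈ W ∧ W ⊆ V := by
  obtain ⟨g, χ, rfl⟩ : ∃ (g : LeftInverseHull S) (χ : domSet g), germArr g χ = γ := by
    obtain ⟨x, y, ⟨k⟩⟩ := γ
    have h : (⟨x, y, Quotient.mk (germSetoid x.1 y.1) k⟩ : Arr (GroupoidP S)) ∈ bisection k.1 :=
      (mk_mem_bisection_iff k k.1).2 GermEq.refl
    exact ⟨k.1, _, germArr_source h⟩
  obtain ⟨C, hC, hχ, hCV⟩ := compact_exists_isClopen_in_isOpen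
    (hV.preimage (continuous_germArr g)) hγ
  exact ⟨_, ⟨g, C, hC, rfl⟩, ⟨χ, hχ, rfl⟩, Set.image_subset_iff.2 hCV⟩

theorem mem_liftSpan_of_isCompactOpenBisection {V W : Set (Arr (GroupoidP S))}
    (hW : IsCompactOpenBisection W) (hWV : W ⊆ V) {f : Arr (GroupoidP S) → ℂ}
    (hf : ContinuousOn f V) : W.indicator f ∈ liftSpan S := by
  classical
  obtain ⟨g, C, hC, rfl⟩ := hW
  refine mem_liftSpan (g := g) (fun γ hγ => Set.indicator_of_notMem ?_ f) ?_
  · rintro ⟨χ, -, rfl⟩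
    refine hγ ?_
    rw [← range_germArr]
    exact ⟨χ, rfl⟩
  · have : (germArr g '' C).indicator f ∘ germArr g = C.indicator (f ∘ germArr g) := by
      funext χ
      by_cases h : χ ∈ C
      · rw [Set.indicator_of_mem h, Function.comp_apply,
          Set.indicator_of_mem (Set.mem_image_of_mem _ h), Function.comp_apply]
      · rw [Set.indicator_of_notMem h, Function.comp_apply, Set.indicator_of_notMem]
        exact fun hc => h ((germArr_injective g).mem_set_image.1 hc)
    rw [this]
    refine continuous_indicator (by simp [hC.frontier_eq]) ?_
    rw [hC.1.closure_eq]
    exact hf.comp (continuous_germArr g).continuousOn fun χ hχ => hWV ⟨χ, hχ, rfl⟩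

/-- Compact sets are closed relative to the Hausdorff set `V`, though possibly not in the whole
space. This is where Hausdorffness of `V` in the definition of `C_c` enters. -/
theorem isOpen_diff_of_isCompact {Y : Type*} [TopologicalSpace Y] {V W : Set Y} (hV : IsOpen V)
    [T2Space V] (hW : IsCompact W) (hWV : W ⊆ V) : IsOpen (V \ W) := by
  have h1 : IsCompact (Subtype.val ⁻¹' W : Set V) := by
    rw [Subtype.isCompact_iff, Subtype.image_preimage_coe, Set.inter_eq_right.2 hWV]
    exact hW
  have h2 := hV.isOpenMap_subtype_val _ h1.isClosed.isOpen_compl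
  rwa [← Set.preimage_compl, Subtype.image_preimage_coe] at h2

theorem continuousOn_indicator_compl {V W : Set (Arr (GroupoidP S))} (hV : IsOpen V) [T2Space V]
    (hW : IsCompactOpenBisection W) (hWV : W ⊆ V) {f : Arr (GroupoidP S) → ℂ}
    (hf : ContinuousOn f V) : ContinuousOn (Wᶜ.indicator f) V := by
  refine continuousOn_of_forall_continuousAt fun γ hγ => ?_
  by_cases h : γ ∈ W
  · have : Wᶜ.indicator f =ᶠ[𝓝 γ] fun _ => 0 := by
      filter_upwards [hW.isOpen.mem_nhds h] with δ hδ
      exact Set.indicator_of_notMem (show δ ∉ Wᶜ from fun hc => hc hδ) f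
    exact continuousAt_const.congr this.symm
  · have : Wᶜ.indicator f =ᶠ[𝓝 γ] f := by
      filter_upwards [(isOpen_diff_of_isCompact hV hW.isCompact hWV).mem_nhds ⟨hγ, h⟩] with δ hδ
      exact Set.indicator_of_mem (show δ ∈ Wᶜ from hδ.2) f
    exact (hf.continuousAt (hV.mem_nhds hγ)).congr this.symm

/-- The bisections are split off one at a time. The remainder stays continuous on `V` because each
one is relatively clopen in `V`, even if the bisections overlap. -/
theorem mem_liftSpan_of_finite {V : Set (Arr (GroupoidP S))} (hV : IsOpen V) [T2Space V]
    (t : Set (Set (Arr (GroupoidP S)))) (ht : t.Finite)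
    (hb : ∀ W ∈ t, IsCompactOpenBisection W ∧ W ⊆ V) :
    ∀ f : Arr (GroupoidP S) → ℂ, ContinuousOn f V → (∀ γ, γ ∉ ⋃₀ t → f γ = 0) →
      f ∈ liftSpan S := by
  induction t, ht using Set.Finite.induction_on with
  | empty =>
    intro f _ hf
    have : f = 0 := funext fun γ => hf γ (by simp)
    rw [this]
    exact zero_mem _
  | @insert W t _ _ ih =>
    intro f hc hf
    obtain ⟨hW, hWV⟩ := hb W (Set.mem_insert W t)
    rw [← Set.indicator_self_add_compl W f]
    refine add_mem (mem_liftSpan_of_isCompactOpenBisection hW hWV hc)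
      (ih (fun W' hW' => hb W' (Set.mem_insert_of_mem W hW')) _
        (continuousOn_indicator_compl hV hW hWV hc) fun γ hγ => ?_)
    by_cases h : γ ∈ W
    · exact Set.indicator_of_notMem (show γ ∉ Wᶜ from fun hc => hc h) f
    · rw [Set.indicator_of_mem (show γ ∈ Wᶜ from h)]
      refine hf γ ?_
      rw [Set.sUnion_insert]
      exact fun hc => hc.elim h hγ

theorem Cc_le_liftSpan : Cc (GroupoidP S) ≤ liftSpan S := by
  refine Submodule.span_le.2 ?_
  rintro f ⟨V, hV, hT2, hf, K, hKV, hK, h0⟩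
  choose! W hW hγW hWV using fun γ (hγ : γ ∈ V) => exists_isCompactOpenBisection hV hγ
  obtain ⟨t, htK, ht⟩ := hK.elim_nhds_subcover W
    fun γ hγ => (hW γ (hKV hγ)).isOpen.mem_nhds (hγW γ (hKV hγ))
  refine mem_liftSpan_of_finite hV (W '' t) (t.finite_toSet.image _) ?_ f hf fun γ hγ =>
    h0 γ fun hc => hγ ?_
  · rintro _ ⟨γ, hγ, rfl⟩
    exact ⟨hW γ (hKV (htK γ hγ)), hWV γ (hKV (htK γ hγ))⟩
  · have := ht hc
    simp only [Set.mem_iUnion] at this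
    obtain ⟨δ, hδ, h⟩ := this
    exact ⟨W δ, ⟨δ, hδ, rfl⟩, h⟩

theorem regRep_mem_closure (f : Cc (GroupoidP S)) :
    regRep f ∈ (indSpan S).topologicalClosure := by
  -- `liftSpan` lies in the space of all functions, whereas `regRep` is defined on `C_c` only, so
  -- the condition is pushed forward along the inclusion.
  have h : liftSpan S ≤ ((indSpan S).topologicalClosure.comap (regRepₗ (GroupoidP S))).map
      (Cc (GroupoidP S)).subtype := by
    refine Submodule.span_le.2 ?_
    rintro _ ⟨g, φ, rfl⟩
    exact ⟨lift g φ, regRep_lift_mem g φ, rfl⟩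
  obtain ⟨f', hf', he⟩ := h (Cc_le_liftSpan f.2)
  obtain rfl : f' = f := Subtype.ext he
  exact hf'

end GroupoidP
end PatersonFunctions

/-! ### Matrices of products, adjoints and unitary conjugates -/

namespace EllTwo

variable {α β γ : Type*}

theorem entry_comp_of_eq {A : EllTwo β →L[ℂ] EllTwo γ} {B : EllTwo α →L[ℂ] EllTwo β}
    {k : α} {m : β} (h : entry B k m = 1) (h' : ∀ l, l ≠ m → entry B k l = 0) (l : γ) :
    entry (A.comp B) k l = entry A m l := by
  classical
  have : B (lp.single 2 k (1 : ℂ)) = lp.single 2 m (1 : ℂ) := lp.ext (funext fun j => by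
    by_cases hj : j = m
    · subst hj
      exact h.trans (lp.single_apply_self (E := fun _ => ℂ) 2 j (1 : ℂ)).symm
    · exact (h' j hj).trans (single_apply_of_ne hj).symm)
  change A (B (lp.single 2 k (1 : ℂ))) l = _
  rw [this]
  rfl

theorem entry_comp_of_eq_zero {A : EllTwo β →L[ℂ] EllTwo γ} {B : EllTwo α →L[ℂ] EllTwo β}
    {k : α} (h : ∀ l, entry B k l = 0) (l : γ) : entry (A.comp B) k l = 0 := by
  classical
  have : B (lp.single 2 k (1 : ℂ)) = 0 := lp.ext (funext fun j => h j)
  change A (B (lp.single 2 k (1 : ℂ))) l = _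
  rw [this, map_zero]
  rfl

theorem entry_star (T : EllTwo α →L[ℂ] EllTwo α) (k l : α) :
    entry (star T) k l = star (entry T l k) := by
  classical
  have h1 : inner ℂ (lp.single 2 l (1 : ℂ) : EllTwo α) (star T (lp.single 2 k (1 : ℂ))) =
      inner ℂ (T (lp.single 2 l (1 : ℂ))) (lp.single 2 k (1 : ℂ) : EllTwo α) :=
    ContinuousLinearMap.adjoint_inner_right T _ _
  rw [lp.inner_single_left, lp.inner_single_right] at h1
  simpa [entry] using h1

open scoped Classical in
theorem reindex_single (e : α ≃ β) (i : α) :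
    reindex e (lp.single 2 i (1 : ℂ)) = lp.single 2 (e i) (1 : ℂ) := lp.ext (funext fun j => by
  obtain ⟨k, rfl⟩ := e.surjective j
  have h1 : e.symm (e k) = k := e.symm_apply_apply k
  change (lp.single 2 i (1 : ℂ) : EllTwo α) (e.symm (e k)) = _
  rw [h1]
  by_cases hk : k = i
  · subst hk
    exact (lp.single_apply_self (E := fun _ => ℂ) 2 k (1 : ℂ)).trans
      (lp.single_apply_self (E := fun _ => ℂ) 2 (e k) (1 : ℂ)).symm
  · exact (single_apply_of_ne hk).trans
      (single_apply_of_ne fun hc => hk (e.injective hc)).symm)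

theorem entry_conj_reindex (e : α ≃ β) (T : EllTwo β →L[ℂ] EllTwo β) (i j : α) :
    entry ((reindex e).symm.conjStarAlgEquiv T) i j = entry T (e i) (e j) := by
  classical
  change T (reindex e (lp.single 2 i (1 : ℂ))) (e j) = _
  rw [reindex_single]
  rfl

end EllTwo

/-! ### The algebra of characteristic functions, and the norm comparison at `χ_e` -/

section PatersonAlgebra

variable {S : Type*} [Monoid S] [IsLeftCancelMul S]

open LeftInverseHull SemiChar

namespace GroupoidP

/-- A representative of an arrow. -/
def rep {x : GroupoidP S} (k : SourceFiber x) : PreHom x.1 k.1.1 := Quotient.out k.2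

theorem mk_rep {x : GroupoidP S} (k : SourceFiber x) :
    k.2 = Quotient.mk (germSetoid x.1 k.1.1) (rep k) := (Quotient.out_eq k.2).symm

theorem eq_iff_germEq {x : GroupoidP S} {k l : SourceFiber x} :
    k = l ↔ x.1.GermEq (rep k).1 (rep l).1 := by
  constructor
  · rintro rfl
    exact GermEq.refl
  · intro h
    have hk := mk_rep k
    have hl := mk_rep l
    generalize rep k = k' at h hk
    generalize rep l = l' at h hl
    obtain ⟨⟨y, hy⟩, k⟩ := k
    obtain ⟨⟨z, hz⟩, l⟩ := l
    have : y = z := SemiChar.ext (funext fun p => by rw [k'.2.2, l'.2.2, h.conj])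
    subst this
    congr 1
    exact hk.trans ((mk_eq_mk_iff.2 h).trans hl.symm)

theorem exists_rep {x : GroupoidP S} {g : LeftInverseHull S} (h : x.1 (Idem.dom g) = true) :
    ∃ k : SourceFiber x, x.1.GermEq (rep k).1 g :=
  ⟨⟨⟨translate g x.1 h, translate_mem_Omega g h x.2⟩,
    Quotient.mk (germSetoid x.1 (translate g x.1 h)) ⟨g, h, fun _ => rfl⟩⟩,
    mk_eq_mk_iff.1 (Quotient.out_eq _)⟩

-- The entry is the value of the characteristic function at the arrow `lk⁻¹`, which lies in
-- `bisection g` exactly when `gk` and `l` have the same germ.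
open scoped Classical in
theorem entry_ind (x : GroupoidP S) (g : LeftInverseHull S) (k l : SourceFiber x) :
    EllTwo.entry (rho x (ind g)) k l =
      if x.1.GermEq (g * (rep k).1) (rep l).1 then 1 else 0 := by
  rw [entry_rho]
  have hhom : (Groupoid.inv k.2 ≫ l.2 : k.1 ⟶ l.1) =
      Quotient.mk (germSetoid k.1.1 l.1.1) ((rep k).inv.comp (rep l)) := by
    rw [mk_rep k, mk_rep l]
    rfl
  have hmem : (⟨k.1, l.1, Groupoid.inv k.2 ≫ l.2⟩ : Arr (GroupoidP S)) ∈ bisection g ↔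
      x.1.GermEq (g * (rep k).1) (rep l).1 := by
    rw [hhom, mk_mem_bisection_iff, ← GermEq.mul_inv_iff]
    rfl
  by_cases h : x.1.GermEq (g * (rep k).1) (rep l).1
  · rw [if_pos h, ind, lift_of_mem (hmem.2 h)]
    rfl
  · rw [if_neg h, ind, lift_of_notMem fun hc => h (hmem.1 hc)]

/-- `ρ_x(1_h)` sends `δ_k` to the basis vector of the germ `hk`, or to 0 when `hk` has no germ at
`x`. The product is therefore governed by composition of germs. -/
theorem rho_ind_mul (x : GroupoidP S) (g h : LeftInverseHull S) :
    rho x (ind g) * rho x (ind h) = rho x (ind (g * h)) := by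
  classical
  refine EllTwo.ext_entry fun k l => ?_
  change EllTwo.entry ((rho x (ind g)).comp (rho x (ind h))) k l = _
  by_cases hd : x.1 (Idem.dom (h * (rep k).1)) = true
  · obtain ⟨m, hm⟩ := exists_rep hd
    rw [EllTwo.entry_comp_of_eq (m := m), entry_ind, entry_ind]
    · refine if_congr ?_ rfl rfl
      rw [mul_assoc]
      exact ⟨fun H => (hm.mul_left g).symm.trans H, fun H => (hm.mul_left g).trans H⟩
    · rw [entry_ind, if_pos hm.symm]
    · intro l' hl'
      rw [entry_ind, if_neg]
      exact fun H => hl' (eq_iff_germEq.2 (H.symm.trans hm.symm))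
  · rw [EllTwo.entry_comp_of_eq_zero, entry_ind, if_neg]
    · intro H
      rw [mul_assoc] at H
      exact hd (GermEq.of_dom_mul (H.dom (rep l).2.1))
    · intro l'
      rw [entry_ind, if_neg]
      exact fun H => hd (H.dom (rep l').2.1)

theorem star_rho_ind (x : GroupoidP S) (g : LeftInverseHull S) :
    star (rho x (ind g)) = rho x (ind g⁻¹) := by
  classical
  refine EllTwo.ext_entry fun k l => ?_
  rw [EllTwo.entry_star, entry_ind, entry_ind]
  have : x.1.GermEq (g * (rep l).1) (rep k).1 ↔ x.1.GermEq (g⁻¹ * (rep k).1) (rep l).1 := by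
    refine ⟨fun H => GermEq.eq_inv_mul (rep k).2.1 H, fun H => ?_⟩
    have := GermEq.eq_inv_mul (rep l).2.1 H
    rwa [inv_inv] at this
  by_cases h : x.1.GermEq (g⁻¹ * (rep k).1) (rep l).1
  · rw [if_pos (this.2 h), if_pos h, star_one]
  · rw [if_neg fun hc => h (this.1 hc), if_neg h, star_zero]

theorem regRep_ind_mul (g h : LeftInverseHull S) :
    regRep (ind g) * regRep (ind h) = regRep (ind (g * h)) :=
  BoundedFamilies.ext_eval fun x => rho_ind_mul x g h

theorem star_regRep_ind (g : LeftInverseHull S) : star (regRep (ind g)) = regRep (ind g⁻¹) :=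
  BoundedFamilies.ext_eval fun x => star_rho_ind x g

theorem mul_mem_indSpan {a b : ProdB (GroupoidP S)} (ha : a ∈ indSpan S) (hb : b ∈ indSpan S) :
    a * b ∈ indSpan S := by
  unfold indSpan at ha hb
  induction ha using Submodule.span_induction with
  | mem _ h =>
    obtain ⟨g, rfl⟩ := h
    induction hb using Submodule.span_induction with
    | mem _ h =>
      obtain ⟨h, rfl⟩ := h
      exact Submodule.subset_span ⟨g * h, (regRep_ind_mul g h).symm⟩
    | zero => rw [mul_zero]; exact zero_mem _
    | add a b _ _ ha hb => rw [mul_add]; exact add_mem ha hb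
    | smul c a _ ha => rw [mul_smul_comm]; exact Submodule.smul_mem _ _ ha
  | zero => rw [zero_mul]; exact zero_mem _
  | add a b _ _ ha hb => rw [add_mul]; exact add_mem ha hb
  | smul c a _ ha => rw [smul_mul_assoc]; exact Submodule.smul_mem _ _ ha

theorem star_mem_indSpan {a : ProdB (GroupoidP S)} (ha : a ∈ indSpan S) :
    star a ∈ indSpan S := by
  unfold indSpan at ha
  induction ha using Submodule.span_induction with
  | mem _ h =>
    obtain ⟨g, rfl⟩ := h
    rw [star_regRep_ind]
    exact Submodule.subset_span ⟨_, rfl⟩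
  | zero => rw [star_zero]; exact zero_mem _
  | add a b _ _ ha hb => rw [star_add]; exact add_mem ha hb
  | smul c a _ ha => rw [star_smul]; exact Submodule.smul_mem _ _ ha

variable (S) in
/-- The span of the characteristic functions of the sets `bisection g` as a `*`-algebra. -/
def indAlgebra : NonUnitalStarSubalgebra ℂ (ProdB (GroupoidP S)) where
  carrier := indSpan S
  add_mem' := add_mem
  zero_mem' := zero_mem (indSpan S)
  smul_mem' c _ h := (indSpan S).smul_mem c h
  mul_mem' ha hb := mul_mem_indSpan ha hb
  star_mem' ha := star_mem_indSpan ha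

/-- The span is already a `*`-algebra and its closure contains `C_c`, so norm estimates and the
computation of the range reduce to linear combinations of characteristic functions. -/
theorem mem_closure_of_mem_reducedCStar {a : ProdB (GroupoidP S)}
    (ha : a ∈ reducedCStar (GroupoidP S)) : a ∈ closure (indSpan S : Set (ProdB (GroupoidP S))) := by
  have h : reducedCStar (GroupoidP S) ≤ (indAlgebra S).topologicalClosure := by
    refine NonUnitalStarSubalgebra.topologicalClosure_minimal _
      (NonUnitalStarAlgebra.adjoin_le ?_)
      (NonUnitalStarSubalgebra.isClosed_topologicalClosure _)
    rintro _ ⟨f, rfl⟩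
    exact regRep_mem_closure f
  exact h ha

/-- The matrix entries of the elements of the span depend only on coincidences between finitely
many germs. -/
theorem exists_finset_entry {a : ProdB (GroupoidP S)} (ha : a ∈ indSpan S) :
    ∃ G : Finset (LeftInverseHull S), ∀ (x x' : GroupoidP S) (k l : SourceFiber x)
      (k' l' : SourceFiber x'),
      (∀ g ∈ G, x.1.GermEq (g * (rep k).1) (rep l).1 ↔ x'.1.GermEq (g * (rep k').1) (rep l').1) →
      EllTwo.entry (BoundedFamilies.eval x a) k l =
        EllTwo.entry (BoundedFamilies.eval x' a) k' l' := by
  classical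
  rw [indSpan] at ha
  induction ha using Submodule.span_induction with
  | mem _ h =>
    obtain ⟨g, rfl⟩ := h
    refine ⟨{g}, fun x x' k l k' l' h => ?_⟩
    refine (entry_ind x g k l).trans (Eq.trans ?_ (entry_ind x' g k' l').symm)
    exact if_congr (h g (Finset.mem_singleton_self g)) rfl rfl
  | zero => exact ⟨∅, fun x x' k l k' l' _ => rfl⟩
  | add a b _ _ ha hb =>
    obtain ⟨G, hG⟩ := ha
    obtain ⟨G', hG'⟩ := hb
    refine ⟨G ∪ G', fun x x' k l k' l' h => ?_⟩
    exact congrArg₂ (· + ·) (hG x x' k l k' l' fun g hg => h g (Finset.mem_union_left _ hg))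
      (hG' x x' k l k' l' fun g hg => h g (Finset.mem_union_right _ hg))
  | smul c a _ ha =>
    obtain ⟨G, hG⟩ := ha
    exact ⟨G, fun x x' k l k' l' h => congrArg (c * ·) (hG x x' k l k' l' h)⟩

/-- Germs at `χ_e` are read off at the identity, and `g` composed with translation by `s` takes the
value `g(s)` there. This describes the matrices over `χ_e` in terms of `S` alone. -/
theorem germEq_rep_toFiber_iff {g : LeftInverseHull S} {s t : S} :
    (chiE S).1.GermEq (g * (rep (toFiber s)).1) (rep (toFiber t)).1 ↔ g.1 s = some t := by
  have h : ∀ u : S, (chiE S).1.GermEq (rep (toFiber u)).1 (of u) := fun u =>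
    mk_eq_mk_iff.1 (Quotient.out_eq (toFiber u).2)
  have h1 : (chiE S).1.GermEq (g * (rep (toFiber s)).1) (rep (toFiber t)).1 ↔
      (chiE S).1.GermEq (g * of s) (of t) :=
    ⟨fun H => ((h s).mul_left g).symm.trans (H.trans (h t)),
      fun H => ((h s).mul_left g).trans (H.trans (h t).symm)⟩
  have h2 : (g * of s).1 1 = g.1 s := by
    change g.1 (s * 1) = g.1 s
    rw [mul_one]
  rw [h1, ← h2]
  exact germEq_point_one_iff

/-- The heart of the proof: evaluating the germs at a separating point `s` copies any finite block
over `x` into the matrix over `χ_e`. -/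
theorem norm_eval_le_of_mem_indSpan (hS : StronglyCStarRegular S) {a : ProdB (GroupoidP S)}
    (ha : a ∈ indSpan S) (x : GroupoidP S) :
    ‖BoundedFamilies.eval x a‖ ≤ ‖BoundedFamilies.eval (chiE S) a‖ := by
  classical
  obtain ⟨G, hG⟩ := exists_finset_entry ha
  refine EllTwo.norm_le_of_blocks _ _ fun t => ?_
  -- The pairs `(gk, l)` with `g ∈ G` control the matrix entries; those with `g = 1` make `k ↦ k(s)`
  -- injective on `t`.
  obtain ⟨s, hs⟩ := hS.exists_separating x.2
    (((insert 1 G) ×ˢ (t ×ˢ t)).image fun y => (y.1 * (rep y.2.1).1, (rep y.2.2).1)) (by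
      intro y hy
      obtain ⟨z, -, rfl⟩ := Finset.mem_image.1 hy
      exact (rep z.2.2).2.1)
  have key : ∀ g ∈ insert 1 G, ∀ k ∈ t, ∀ l ∈ t, ((rep l).1.1 s).isSome = true ∧
      ((g * (rep k).1).1 s = (rep l).1.1 s ↔ x.1.GermEq (g * (rep k).1) (rep l).1) :=
    fun g hg k hk l hl => hs _ (Finset.mem_image.2 ⟨(g, k, l), by simp_all, rfl⟩)
  have h1 := Finset.mem_insert_self 1 G
  have hval : ∀ k ∈ t, (rep k).1.1 s = some (((rep k).1.1 s).getD 1) := by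
    intro k hk
    obtain ⟨u, hu⟩ := Option.isSome_iff_exists.1 (key 1 h1 k hk k hk).1
    rw [hu]
    rfl
  -- The default 1 is never used on `t`, where every representative is defined at `s`.
  refine ⟨fun k => toFiber (((rep k).1.1 s).getD 1), ?_, fun k hk l hl => ?_⟩
  · intro k hk l hl h
    have h2 : ((rep k).1.1 s).getD 1 = ((rep l).1.1 s).getD 1 := toFiber_bijective.1 h
    refine eq_iff_germEq.2 ?_
    have := (key 1 h1 k hk l hl).2.1 (by rw [one_mul, hval k hk, hval l hl, h2])
    rwa [one_mul] at this
  · refine hG _ _ _ _ _ _ fun g hg => ?_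
    rw [germEq_rep_toFiber_iff, ← (key g (Finset.mem_insert_of_mem hg) k hk l hl).2, mul_apply,
      hval k hk, hval l hl]
    rfl

theorem continuous_eval_family (x : GroupoidP S) :
    Continuous (BoundedFamilies.eval (H := fun x : GroupoidP S => EllTwo (SourceFiber x)) x) :=
  AddMonoidHomClass.continuous_of_bound _ 1 fun a => by
    rw [one_mul]
    exact BoundedFamilies.norm_eval_le a x

theorem norm_eval_chiE (hS : StronglyCStarRegular S) {a : ProdB (GroupoidP S)}
    (ha : a ∈ reducedCStar (GroupoidP S)) : ‖BoundedFamilies.eval (chiE S) a‖ = ‖a‖ := by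
  refine le_antisymm (BoundedFamilies.norm_eval_le a _)
    (BoundedFamilies.norm_le (norm_nonneg _) fun x => ?_)
  have hcl : IsClosed {a | ‖BoundedFamilies.eval x a‖ ≤ ‖BoundedFamilies.eval (chiE S) a‖} :=
    isClosed_le (continuous_eval_family x).norm (continuous_eval_family (chiE S)).norm
  exact hcl.closure_subset_iff.2 (fun b hb => norm_eval_le_of_mem_indSpan hS hb x)
    (mem_closure_of_mem_reducedCStar ha)

/-- The representation `ρ_{χ_e}` on `ℓ²(S)`. -/
def rhoE : ProdB (GroupoidP S) →⋆ₙₐ[ℂ] (EllTwo S →L[ℂ] EllTwo S) :=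
  ((EllTwo.reindex (fiberEquiv S)).symm.conjStarAlgEquiv :
    (EllTwo (SourceFiber (chiE S)) →L[ℂ] EllTwo (SourceFiber (chiE S))) →⋆ₙₐ[ℂ]
      (EllTwo S →L[ℂ] EllTwo S)).comp (BoundedFamilies.eval (chiE S))

theorem norm_rhoE (a : ProdB (GroupoidP S)) : ‖rhoE a‖ = ‖BoundedFamilies.eval (chiE S) a‖ :=
  StarAlgEquiv.norm_map (EllTwo.reindex (fiberEquiv S)).symm.conjStarAlgEquiv _

theorem continuous_rhoE : Continuous (rhoE (S := S)) :=
  AddMonoidHomClass.continuous_of_bound _ 1 fun a => by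
    rw [one_mul, norm_rhoE]
    exact BoundedFamilies.norm_eval_le a _

theorem entry_rhoE (a : ProdB (GroupoidP S)) (s t : S) :
    EllTwo.entry (rhoE a) s t =
      EllTwo.entry (BoundedFamilies.eval (chiE S) a) (toFiber s) (toFiber t) :=
  EllTwo.entry_conj_reindex (fiberEquiv S) _ s t

theorem rhoE_ind_of (s : S) : rhoE (regRep (ind (of s))) = leftRegular s := by
  classical
  refine EllTwo.ext_entry fun u t => ?_
  rw [entry_rhoE]
  refine (entry_ind _ _ _ _).trans ?_
  have h1 : (of s).1 u = some t ↔ s * u = t := by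
    change some (s * u) = some t ↔ _
    rw [Option.some_inj]
  rw [EllTwo.entry, leftRegular_single]
  by_cases h : s * u = t
  · subst h
    rw [if_pos (germEq_rep_toFiber_iff.2 (h1.2 rfl))]
    exact (lp.single_apply_self (E := fun _ => ℂ) 2 (s * u) (1 : ℂ)).symm
  · rw [if_neg fun hc => h (h1.1 (germEq_rep_toFiber_iff.1 hc))]
    exact (EllTwo.single_apply_of_ne fun hc => h hc.symm).symm

/-- Induction on the generation of `I_ℓ(S)`: translations give the `λ_s`, inverses give adjoints,
compositions give products. -/
theorem rhoE_ind_mem (g : LeftInverseHull S) :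
    rhoE (regRep (ind g)) ∈ monoidReducedCStar S := by
  obtain ⟨f, hf⟩ := g
  induction hf with
  | translation s =>
    change rhoE (regRep (ind (of s))) ∈ _
    rw [rhoE_ind_of]
    exact NonUnitalStarSubalgebra.le_topologicalClosure _
      (NonUnitalStarAlgebra.subset_adjoin ℂ _ ⟨s, rfl⟩)
  | @symm f hf ih =>
    have := star_mem ih
    rw [← map_star, star_regRep_ind] at this
    exact this
  | @trans f f' hf hf' ih ih' =>
    -- The product in `I_ℓ(S)` reverses the order of `PEquiv.trans`.
    have := mul_mem ih' ih
    rw [← _root_.map_mul, regRep_ind_mul] at this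
    exact this

theorem rhoE_mem {a : ProdB (GroupoidP S)} (ha : a ∈ reducedCStar (GroupoidP S)) :
    rhoE a ∈ monoidReducedCStar S := by
  have hcl : IsClosed {a : ProdB (GroupoidP S) | rhoE a ∈ monoidReducedCStar S} :=
    (NonUnitalStarSubalgebra.isClosed_topologicalClosure _).preimage continuous_rhoE
  refine hcl.closure_subset_iff.2 (fun b hb => ?_) (mem_closure_of_mem_reducedCStar ha)
  change b ∈ indSpan S at hb
  change rhoE b ∈ monoidReducedCStar S
  rw [indSpan] at hb
  induction hb using Submodule.span_induction with
  | mem _ h =>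
    obtain ⟨g, rfl⟩ := h
    exact rhoE_ind_mem g
  | zero => rw [map_zero]; exact zero_mem _
  | add a b _ _ ha hb => rw [map_add]; exact add_mem ha hb
  | smul c a _ ha => rw [map_smul]; exact SMulMemClass.smul_mem c ha

variable (S) in
/-- The representation `ρ_{χ_e}` of `C*_r(𝒢_P(S))` on `ℓ²(S)`. -/
def reducedRhoE : reducedCStar (GroupoidP S) →⋆ₙₐ[ℂ] (EllTwo S →L[ℂ] EllTwo S) :=
  rhoE.comp (NonUnitalStarSubalgebraClass.subtype (reducedCStar (GroupoidP S)))

theorem isometry_reducedRhoE (hS : StronglyCStarRegular S) : Isometry (reducedRhoE S) :=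
  AddMonoidHomClass.isometry_of_norm _ fun a => (norm_rhoE a.1).trans (norm_eval_chiE hS a.2)

/-- The range is a `*`-algebra containing every `λ_s`, and it is closed as the isometric image of a
complete space. -/
theorem monoidReducedCStar_le_range (hS : StronglyCStarRegular S) :
    monoidReducedCStar S ≤ NonUnitalStarAlgHom.range (reducedRhoE S) := by
  have : CompleteSpace (reducedCStar (GroupoidP S)) :=
    (NonUnitalStarSubalgebra.isClosed_topologicalClosure _).completeSpace_coe
  refine NonUnitalStarSubalgebra.topologicalClosure_minimal _
    (NonUnitalStarAlgebra.adjoin_le ?_) ?_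
  · rintro _ ⟨s, rfl⟩
    exact ⟨⟨regRep (ind (of s)), NonUnitalStarSubalgebra.le_topologicalClosure _
      (NonUnitalStarAlgebra.subset_adjoin ℂ _ ⟨_, rfl⟩)⟩, rhoE_ind_of s⟩
  · exact (isometry_reducedRhoE hS).isClosedEmbedding.isClosed_range

end GroupoidP
end PatersonAlgebra

end

theorem proposition2p5 {S : Type*} [Monoid S] [IsLeftCancelMul S]
    (hS : StronglyCStarRegular S) :
    ∃ Φ : reducedCStar (GroupoidP S) ≃⋆ₐ[ℂ] monoidReducedCStar S,
      ∀ a : reducedCStar (GroupoidP S),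
        (Φ a : EllTwo S →L[ℂ] EllTwo S) =
          (EllTwo.reindex (fiberEquiv S)).symm.conjStarAlgEquiv (reducedRho (chiE S) a) := by
  let φ := NonUnitalStarAlgHom.codRestrict (GroupoidP.reducedRhoE S) (monoidReducedCStar S)
    fun a => GroupoidP.rhoE_mem a.2
  refine ⟨StarAlgEquiv.ofBijective φ ⟨fun a b h => ?_, fun y => ?_⟩, fun a => rfl⟩
  · exact (GroupoidP.isometry_reducedRhoE hS).injective (congrArg Subtype.val h)
  · obtain ⟨a, ha⟩ := GroupoidP.monoidReducedCStar_le_range hS y.2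
    exact ⟨a, Subtype.ext ha⟩
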